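/- **Setting.** Let $N\ge 1$ be an integer and $r_1>r_2>\dots>r_N>0$. In $\mathbb R^2$, with $r=|\mathbf x|$, put $D_0=\{r>r_1\}$, $D_j=\{r_{j+1}<r\le r_j\}$ for $1\le j\le N-1$, and $D_N=\{r\le r_N\}$. Let $\lambda,\mu\in\mathbb R$ with $\mu>0$ and $2\lambda+2\mu>0$; let $\varepsilon_0>0$ and $\varepsilon_1,\dots,\varepsilon_N\in\mathbb C$ with $\Im\varepsilon_j\ge 0$ and $\varepsilon_{j-1}\ne\varepsilon_j$ for $j=1,\dots,N$. Let $\varepsilon(\mathbf x)=\sum_{j=0}^N\varepsilon_j\chi(D_j)$, $(\tilde\lambda,\tilde\mu)=\varepsilon(\mathbf x)(\lambda,\mu)$, and let $\mathbf H=\tilde a_0\mathbf x$ with $\tilde a_0\in\mathbb C$. Consider the Lamé system $$\nabla\cdot\mathbf C_{\tilde\lambda,\tilde\mu}\nabla^s\mathbf u=0\ \text{ in }\mathbb R^2,\qquad \mathbf u-\mathbf H=\mathcal O(|\mathbf x|^{-1}),\ |\mathbf x|\to\infty,$$ for $\mathbf u\in H^1_{loc}(\mathbb R^2)^2$ (complex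 valued), where the equation is understood in the weak sense, $\nabla^s\mathbf u=\frac12(\nabla\mathbf u+\nabla\mathbf u^T)$ and $C_{ijkl}=\tilde\lambda\delta_{ij}\delta_{kl}+\tilde\mu(\delta_{ik}\delta_{jl}+\delta_{il}\delta_{jk})$. Define $$\tilde\beta_j=\frac{\frac{\mu}{\lambda+\mu}\varepsilon_{j-1}+\varepsilon_j}{\varepsilon_{j-1}-\varepsilon_j},\quad j=1,\dots,N,$$ let $\tilde{\mathbb P}_N$ be the $N\times N$ matrix with diagonal entries $(\tilde{\mathbb P}_N)_{jj}=\tilde\beta_j$, entries $(\tilde{\mathbb P}_N)_{ij}=-1$ for $i<j$ and $(\tilde{\mathbb P}_N)_{ij}=\frac{\mu}{\lambda+\mu}(r_i/r_j)^2$ for $i>j$, and let $\tilde\Upsilon_N=\mathrm{diag}(r_1^2,\dots,r_N^2)$, $\mathbf e=(1,\dots,1)^T\in\mathbb R^N$. **Theorem.** (i) Suppose $\mathbf u$ is the solution of the Lamé system, that is, $\mathbf u$ is a solution and every solution equals $\mathbf u$ almost everywhere. Then $\tilde{\mathbb P}_N$ is invertible and $$\mathbf u-\mathbf H=r^{-2}\,\mathbf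 e^T\tilde\Upsilon_N(\tilde{\mathbb P}_N^T)^{-1}\mathbf e\,\mathbf H\qquad\text{almost everywhere in } D_0.\tag{$*$}$$ (ii) If $\tilde{\mathbb P}_N$ is invertible, then the Lamé system has a radial solution $\mathbf u$ (one with $\mathbf u(\mathbf x)=f(|\mathbf x|)\,\mathbf x$ almost everywhere for some $f:\mathbb R\to\mathbb C$) that satisfies $(*)$. If moreover $\varepsilon_j\neq0$ for $j=1,\dots,N$, then every radial solution equals this $\mathbf u$ almost everywhere. -/

import Mathlib

open MeasureTheory
open scoped ContDiff

namespace Lame2D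

noncomputable section

/-- The physical plane `ℝ²`. -/
abbrev Plane := EuclideanSpace ℝ (Fin 2)

/-- The space `ℂ²` of values of displacement fields. -/
abbrev CVec := EuclideanSpace ℂ (Fin 2)

/-- The layers: `D₀ = {r₁ < |x|}`, `D_j = {r_{j+1} < |x| ≤ r_j}` for `1 ≤ j < N`,
and `D_N = {|x| ≤ r_N}`. -/
def layer (N : ℕ) (r : ℕ → ℝ) (j : ℕ) : Set Plane :=
  {x | (1 ≤ j → ‖x‖ ≤ r j) ∧ (j < N → r (j + 1) < ‖x‖)}

/-- The layered coefficient `ε(x) = ∑_{j=0}^N ε_j χ(D_j)(x)`. -/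
def epsField (N : ℕ) (r : ℕ → ℝ) (ε : ℕ → ℂ) (x : Plane) : ℂ :=
  ∑ j ∈ Finset.range (N + 1), (layer N r j).indicator (fun _ => ε j) x

/-- The Kronecker delta. -/
def kron (i j : Fin 2) : ℂ := if i = j then 1 else 0

/-- The isotropic elasticity tensor
`C_{ijkl} = lam δ_{ij} δ_{kl} + mu (δ_{ik} δ_{jl} + δ_{il} δ_{jk})`. -/
def elasticTensor (lam mu : ℂ) (i j k l : Fin 2) : ℂ :=
  lam * (kron i j * kron k l) + mu * (kron i k * kron j l + kron i l * kron j k)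

/-- The symmetric part of a matrix (the strain, when `G` is the displacement gradient). -/
def symPart (G : Fin 2 → Fin 2 → ℂ) (k l : Fin 2) : ℂ := (G k l + G l k) / 2

/-- The partial derivative `∂_j φ (x)` of a real function on the plane. -/
def partialDeriv (φ : Plane → ℝ) (j : Fin 2) (x : Plane) : ℝ :=
  fderiv ℝ φ x (EuclideanSpace.single j 1)

/-- Real smooth compactly supported functions on the plane. -/
def IsTest (φ : Plane → ℝ) : Prop := ContDiff ℝ ∞ φ ∧ HasCompactSupport φ

/-- `f ∈ L²_loc(ℝ²)`. -/
def IsL2Loc (f : Plane → ℂ) : Prop :=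
  ∀ K : Set Plane, IsCompact K → MemLp f 2 (volume.restrict K)

/-- `u ∈ H¹_loc(ℝ²)²` with weak gradient `G`, where `G x i j = ∂_j u_i (x)`. -/
structure HasH1LocGrad (u : Plane → CVec) (G : Plane → Fin 2 → Fin 2 → ℂ) : Prop where
  l2 : ∀ i, IsL2Loc (fun x => u x i)
  l2_grad : ∀ i j, IsL2Loc (fun x => G x i j)
  weak : ∀ i j, ∀ φ : Plane → ℝ, IsTest φ →
    ∫ x, u x i * (partialDeriv φ j x : ℂ) = -∫ x, G x i j * (φ x : ℂ)

/-- `∇ · C ∇ˢu = 0` in the sense of distributions on `ℝ²`, where `G` is the weak gradient of `u`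
and `C` is the elasticity tensor with Lamé parameters `ε(x) (lam, mu)`. -/
def IsWeakLame (eps : Plane → ℂ) (lam mu : ℝ) (G : Plane → Fin 2 → Fin 2 → ℂ) : Prop :=
  ∀ φ : Fin 2 → Plane → ℝ, (∀ i, IsTest (φ i)) →
    ∫ x, ∑ i, ∑ j,
      (∑ k, ∑ l, elasticTensor (eps x * lam) (eps x * mu) i j k l * symPart (G x) k l)
        * (partialDeriv (φ i) j x : ℂ) = 0

/-- The position vector, as an element of `ℂ²`. -/
def position (x : Plane) : CVec := WithLp.toLp 2 (fun i => (x i : ℂ))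

/-- The background field `H(x) = a₀ x`. -/
def background (a₀ : ℂ) (x : Plane) : CVec := a₀ • position x

/-- `u - H = O(|x|⁻¹)` as `|x| → ∞`. Fields are determined up to null sets. -/
def DecaysTo (u H : Plane → CVec) : Prop :=
  ∃ C R : ℝ, 0 < R ∧ ∀ᵐ x : Plane, R ≤ ‖x‖ → ‖u x - H x‖ ≤ C * ‖x‖⁻¹

/-- `u ∈ H¹_loc(ℝ²)²` solves the Lamé system with the layered Lamé parameters
`ε(x) (lam, mu)` and background field `H`. -/
def IsSolution (N : ℕ) (r : ℕ → ℝ) (ε : ℕ → ℂ) (lam mu : ℝ) (H u : Plane → CVec) : Prop :=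
  (∃ G, HasH1LocGrad u G ∧ IsWeakLame (epsField N r ε) lam mu G) ∧ DecaysTo u H

/-- `u` is the solution of the Lamé system: it is a solution and (almost everywhere) the only one. -/
def IsTheSolution (N : ℕ) (r : ℕ → ℝ) (ε : ℕ → ℂ) (lam mu : ℝ) (H u : Plane → CVec) : Prop :=
  IsSolution N r ε lam mu H u ∧ ∀ v, IsSolution N r ε lam mu H v → v =ᵐ[volume] u

/-- Radial vector fields, `u(x) = f(|x|) x` almost everywhere, with an arbitrary profile `f`. -/
def IsRadial (u : Plane → CVec) : Prop :=
  ∃ f : ℝ → ℂ, ∀ᵐ x : Plane, u x = f ‖x‖ • position x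

/-- `β̃_j = (mu / (lam + mu) ε_{j-1} + ε_j) / (ε_{j-1} - ε_j)`, used for `j ≥ 1`. -/
def betaT (lam mu : ℝ) (ε : ℕ → ℂ) (j : ℕ) : ℂ :=
  ((mu / (lam + mu) : ℝ) * ε (j - 1) + ε j) / (ε (j - 1) - ε j)

/-- The two-dimensional elastic momentum matrix `P̃_N`; the index `i : Fin N` stands for the
layer `i + 1`. -/
def momentumMatrix (N : ℕ) (r : ℕ → ℝ) (lam mu : ℝ) (ε : ℕ → ℂ) :
    Matrix (Fin N) (Fin N) ℂ :=
  Matrix.of fun i j =>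
    if i = j then betaT lam mu ε (i + 1)
    else if i < j then -1
    else ((mu / (lam + mu) * (r (i + 1) / r (j + 1)) ^ 2 : ℝ) : ℂ)

/-- `Υ̃_N = diag(r₁², …, r_N²)`. -/
def radiiMatrix (N : ℕ) (r : ℕ → ℝ) : Matrix (Fin N) (Fin N) ℂ :=
  Matrix.diagonal fun i => ((r (i + 1) ^ 2 : ℝ) : ℂ)

/-- `|x|⁻² eᵀ Υ̃_N (P̃_Nᵀ)⁻¹ e H(x)` with `e = (1, …, 1)ᵀ`. -/
def perturbation (N : ℕ) (r : ℕ → ℝ) (lam mu : ℝ) (ε : ℕ → ℂ) (H : Plane → CVec)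
    (x : Plane) : CVec :=
  (((‖x‖ ^ 2)⁻¹ : ℝ) : ℂ) •
    ((fun _ : Fin N => (1 : ℂ)) ⬝ᵥ
      (radiiMatrix N r * ((momentumMatrix N r lam mu ε).transpose)⁻¹).mulVec
        (fun _ => 1)) • H x

/-- The representation `u - H = |x|⁻² eᵀ Υ̃_N (P̃_Nᵀ)⁻¹ e H` in the exterior `D₀`. -/
def HasRepresentation (N : ℕ) (r : ℕ → ℝ) (lam mu : ℝ) (ε : ℕ → ℂ)
    (H u : Plane → CVec) : Prop :=
  ∀ᵐ x : Plane, x ∈ layer N r 0 → u x - H x = perturbation N r lam mu ε H x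

end

end Lame2D

/-! Radial fields with finitely many interfaces form a finite-dimensional space: `layeredField` is
`a₀ x` plus multiples `t k` of the continuous fields that equal `x` in a disc and its inversion
outside. In layer `j` it reads `(A_j + B_j / |x|²) x`. It is continuous for every `t`, so the only
transmission condition left is continuity of the normal stress, `FluxCondition`. Written in terms of
`t`, these `N` conditions are the system `P̃ᵀ t = a₀ e` (`fluxCondition_iff`), and the exterior
coefficient `B_0 = ∑ t_k r_k²` gives the stated formula.

A layered field with the flux conditions solves the equation by a planar device: its stress is the
cofactor matrix of the gradient of a second layered field, and the flux conditions are precisely the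
continuity of that field (`exists_stress_eq_cofactor`). Cofactors of gradients are weakly divergence
free since mixed partial derivatives commute, so no integration by parts over layers is needed.

For (i), a kernel vector of `P̃ᵀ` would give a nonzero layered field with zero background that could
be added to `u`, against uniqueness (`layeredField_injective`). Hence `P̃` is invertible, the
layered solution exists, and `u` equals it.

For the uniqueness in (ii), a radial field `f(|x|) x` is encoded by `M(s) = s f(√s)` with `s =
|x|²`, whose divergence is `2 M'(s)`. Testing with `ψ(|x|²) x` gives `M'' = 0` weakly in each layer
where `ε_j ≠ 0` (`exists_affine_profile`). Local integrability of the divergence forbids jumps of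
`M`, also at `s = 0`, which removes the singular term in the core (`profile_continuous`). The field
is therefore layered, the decay fixes its background, the weak equation returns the flux conditions
(`fluxCondition_of_isWeakLame`), and these determine `t`. -/

namespace Lame2D

/-! ### Test functions and locally square integrable functions -/

lemma IsTest.partialDeriv {φ : Plane → ℝ} (h : IsTest φ) (j : Fin 2) :
    IsTest (partialDeriv φ j) := by
  refine ⟨?_, ?_⟩
  · exact (h.1.fderiv_right (m := ∞) (by simp)).clm_apply contDiff_const
  · exact (h.2.fderiv ℝ).comp_left (g := fun L : Plane →L[ℝ] ℝ => L (EuclideanSpace.single j 1))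
      (by simp)

lemma IsTest.mul {φ ψ : Plane → ℝ} (hφ : ContDiff ℝ ∞ φ) (hψ : IsTest ψ) :
    IsTest (fun x => φ x * ψ x) :=
  ⟨hφ.mul hψ.1, hψ.2.mul_left⟩

lemma partialDeriv_comm {φ : Plane → ℝ} (h : IsTest φ) (j k : Fin 2) (x : Plane) :
    partialDeriv (partialDeriv φ j) k x = partialDeriv (partialDeriv φ k) j x := by
  have hd : DifferentiableAt ℝ (fderiv ℝ φ) x :=
    (h.1.fderiv_right (m := ∞) (by simp)).differentiable (by simp) x
  have key : ∀ a b : Fin 2, Lame2D.partialDeriv (Lame2D.partialDeriv φ a) b x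
      = fderiv ℝ (fderiv ℝ φ) x (EuclideanSpace.single b 1) (EuclideanSpace.single a 1) := by
    intro a b
    unfold Lame2D.partialDeriv
    rw [fderiv_clm_apply hd (differentiableAt_const _)]
    simp
  rw [key, key]
  exact ((contDiff_infty.1 h.1 2).contDiffAt.isSymmSndFDerivAt
    (by rw [minSmoothness_of_isRCLikeNormedField]; rfl)) _ _

lemma IsL2Loc.locallyIntegrable {f : Plane → ℂ} (h : IsL2Loc f) :
    LocallyIntegrable f volume := by
  rw [locallyIntegrable_iff]
  intro K hK
  have : IsFiniteMeasure (volume.restrict K) := ⟨by simpa using hK.measure_lt_top⟩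
  exact (h K hK).integrable (by norm_num)

lemma IsL2Loc.integrable_mul {f : Plane → ℂ} (h : IsL2Loc f) {φ : Plane → ℝ} (hφ : IsTest φ) :
    Integrable (fun x => f x * (φ x : ℂ)) := by
  have := h.locallyIntegrable.integrable_smul_right_of_hasCompactSupport
    (g := fun x => (φ x : ℂ)) (Complex.continuous_ofReal.comp hφ.1.continuous)
    (hφ.2.comp_left (g := ((↑) : ℝ → ℂ)) (by simp))
  simpa using this

lemma IsL2Loc.add_mul {f g : Plane → ℂ} (hf : IsL2Loc f) (hg : IsL2Loc g) (c : ℂ) :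
    IsL2Loc (fun x => f x + c * g x) :=
  fun K hK => (hf K hK).add ((hg K hK).const_mul c)

lemma isL2Loc_of_bound {f : Plane → ℂ} (hf : AEStronglyMeasurable f volume)
    (h : ∀ K : Set Plane, IsCompact K → ∃ C, ∀ᵐ x ∂(volume.restrict K), ‖f x‖ ≤ C) :
    IsL2Loc f := by
  intro K hK
  have : IsFiniteMeasure (volume.restrict K) := ⟨by simpa using hK.measure_lt_top⟩
  obtain ⟨C, hC⟩ := h K hK
  exact MemLp.of_bound hf.restrict C hC

lemma isL2Loc_of_continuous {f : Plane → ℂ} (hf : Continuous f) : IsL2Loc f := by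
  refine isL2Loc_of_bound hf.aestronglyMeasurable fun K hK => ?_
  obtain ⟨C, hC⟩ := hK.exists_bound_of_continuousOn hf.continuousOn
  exact ⟨C, (ae_restrict_iff' hK.measurableSet).2 (Filter.Eventually.of_forall hC)⟩

/-! ### Weak gradients -/

lemma HasH1LocGrad.add_smul {u v : Plane → CVec} {G G' : Plane → Fin 2 → Fin 2 → ℂ}
    (hu : HasH1LocGrad u G) (hv : HasH1LocGrad v G') (c : ℂ) :
    HasH1LocGrad (fun x => u x + c • v x) (fun x i j => G x i j + c * G' x i j) where
  l2 i := by simpa using (hu.l2 i).add_mul (hv.l2 i) c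
  l2_grad i j := (hu.l2_grad i j).add_mul (hv.l2_grad i j) c
  weak i j φ hφ := by
    have e1 : ∀ x, (u x + c • v x) i * (partialDeriv φ j x : ℂ)
        = u x i * (partialDeriv φ j x : ℂ) + c * (v x i * (partialDeriv φ j x : ℂ)) := by
      intro x; simp; ring
    have e2 : ∀ x, (G x i j + c * G' x i j) * (φ x : ℂ)
        = G x i j * (φ x : ℂ) + c * (G' x i j * (φ x : ℂ)) := by
      intro x; ring
    simp_rw [e1, e2]
    rw [integral_add ((hu.l2 i).integrable_mul (hφ.partialDeriv j))
        (((hv.l2 i).integrable_mul (hφ.partialDeriv j)).const_mul c),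
      integral_add ((hu.l2_grad i j).integrable_mul hφ)
        (((hv.l2_grad i j).integrable_mul hφ).const_mul c),
      integral_const_mul, integral_const_mul, hu.weak i j φ hφ, hv.weak i j φ hφ]
    ring

lemma HasH1LocGrad.add_sum {ι : Type*} (s : Finset ι) (c : ι → ℂ) {u : Plane → CVec}
    {G : Plane → Fin 2 → Fin 2 → ℂ} {v : ι → Plane → CVec}
    {G' : ι → Plane → Fin 2 → Fin 2 → ℂ} (hu : HasH1LocGrad u G)
    (hv : ∀ k, HasH1LocGrad (v k) (G' k)) :
    HasH1LocGrad (fun x => u x + ∑ k ∈ s, c k • v k x)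
      (fun x i j => G x i j + ∑ k ∈ s, c k * G' k x i j) := by
  classical
  induction s using Finset.induction_on with
  | empty => simpa using hu
  | insert a s ha ih =>
    have := ih.add_smul (hv a) (c a)
    convert this using 2
    · rw [Finset.sum_insert ha]; abel
    · ext i j; rw [Finset.sum_insert ha]; ring

/-- The cofactor matrix of a weak gradient is weakly divergence free. -/
lemma HasH1LocGrad.integral_swap {u : Plane → CVec} {G : Plane → Fin 2 → Fin 2 → ℂ}
    (hu : HasH1LocGrad u G) {φ : Plane → ℝ} (hφ : IsTest φ) (i j k : Fin 2) :
    ∫ x, G x i j * (partialDeriv φ k x : ℂ) = ∫ x, G x i k * (partialDeriv φ j x : ℂ) := by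
  have h1 := hu.weak i j _ (hφ.partialDeriv k)
  have h2 := hu.weak i k _ (hφ.partialDeriv j)
  simp_rw [partialDeriv_comm hφ k j] at h1
  rw [h1] at h2
  exact neg_injective h2

/-- Uniqueness of weak gradients. It lets a weak equation known for an unspecified gradient be moved
to the explicit `layeredGrad`. -/
lemma HasH1LocGrad.ae_eq {u v : Plane → CVec} {G G' : Plane → Fin 2 → Fin 2 → ℂ}
    (hu : HasH1LocGrad u G) (hv : HasH1LocGrad v G') (h : u =ᵐ[volume] v) :
    ∀ᵐ x, ∀ i j, G x i j = G' x i j := by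
  rw [ae_all_iff]; intro i
  rw [ae_all_iff]; intro j
  have := ae_eq_of_integral_contDiff_smul_eq (μ := volume) (hu.l2_grad i j).locallyIntegrable
    (hv.l2_grad i j).locallyIntegrable (fun φ h1 h2 => ?_)
  · exact this
  · have e1 := hu.weak i j φ ⟨h1, h2⟩
    have e2 := hv.weak i j φ ⟨h1, h2⟩
    have e3 : ∫ x, u x i * (partialDeriv φ j x : ℂ) = ∫ x, v x i * (partialDeriv φ j x : ℂ) := by
      refine integral_congr_ae ?_
      filter_upwards [h] with x hx
      rw [hx]
    rw [e1, e2] at e3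
    have e4 := neg_injective e3
    simpa [mul_comm] using e4

lemma HasH1LocGrad.congr {u v : Plane → CVec} {G : Plane → Fin 2 → Fin 2 → ℂ}
    (hu : HasH1LocGrad u G) (h : u =ᵐ[volume] v) : HasH1LocGrad v G where
  l2 i K hK := by
    refine (memLp_congr_ae ?_).1 (hu.l2 i K hK)
    filter_upwards [ae_restrict_of_ae h] with x hx
    rw [hx]
  l2_grad := hu.l2_grad
  weak i j φ hφ := by
    rw [← hu.weak i j φ hφ]
    refine integral_congr_ae ?_
    filter_upwards [h] with x hx
    rw [hx]

/-- A real Lipschitz field has its almost everywhere derivative as weak gradient. -/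
lemma hasH1LocGrad_of_lipschitz {f : Plane → Fin 2 → ℝ} {g : Plane → Fin 2 → Fin 2 → ℝ}
    {C : NNReal} (hf : ∀ i, LipschitzWith C (fun x => f x i))
    (hg : ∀ i j, ∀ᵐ x, lineDeriv ℝ (fun x => f x i) x (EuclideanSpace.single j 1) = g x i j) :
    HasH1LocGrad (fun x => WithLp.toLp 2 (fun i => (f x i : ℂ)))
      (fun x i j => (g x i j : ℂ)) where
  l2 i := isL2Loc_of_continuous (Complex.continuous_ofReal.comp (hf i).continuous)
  l2_grad i j := by
    have hm : AEStronglyMeasurable (fun x => (g x i j : ℂ)) (volume : Measure Plane) := by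
      refine Complex.continuous_ofReal.comp_aestronglyMeasurable ?_
      refine AEStronglyMeasurable.congr ?_ (hg i j)
      exact (measurable_lineDeriv (hf i).continuous).aestronglyMeasurable
    refine isL2Loc_of_bound hm fun K hK => ⟨C * ‖(EuclideanSpace.single j 1 : Plane)‖, ?_⟩
    refine ae_restrict_of_ae ?_
    filter_upwards [hg i j] with x hx
    rw [← hx, Complex.norm_real]
    exact norm_lineDeriv_le_of_lipschitz ℝ (hf i)
  weak i j φ hφ := by
    obtain ⟨D, hD⟩ : ∃ D, LipschitzWith D φ :=
      (hφ.1.of_le (by simp)).lipschitzWith_of_hasCompactSupport hφ.2 (n := 1) (by simp)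
    have key := (hf i).integral_lineDeriv_mul_eq hD hφ.2 (EuclideanSpace.single j 1)
      (μ := volume)
    have e1 : ∫ x, g x i j * φ x = -∫ x, f x i * partialDeriv φ j x := by
      rw [← integral_neg, ← integral_congr_ae (μ := volume)
        (f := fun x => lineDeriv ℝ (fun x => f x i) x (EuclideanSpace.single j 1) * φ x), key]
      · refine integral_congr_ae (Filter.Eventually.of_forall fun x => ?_)
        have hd : DifferentiableAt ℝ φ x := hφ.1.differentiable (by simp) x
        simp only [hd.lineDeriv_eq_fderiv, map_neg, partialDeriv]
        ring
      · filter_upwards [hg i j] with x hx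
        rw [hx]
    have e2 : ∫ x, (g x i j : ℂ) * (φ x : ℂ) = ((∫ x, g x i j * φ x : ℝ) : ℂ) := by
      rw [← integral_complex_ofReal]; simp
    have e3 : ∫ x, (f x i : ℂ) * (partialDeriv φ j x : ℂ)
        = ((∫ x, f x i * partialDeriv φ j x : ℝ) : ℂ) := by
      rw [← integral_complex_ofReal]; simp
    dsimp only
    rw [e2, e1, e3]
    simp

/-! ### The building block: identity in a disc, inversion outside -/

noncomputable section

/-- The field equal to `x` in the disc of radius `r` and to its inversion `r² x / |x|²` outside. -/
def cutField (r : ℝ) (x : Plane) : Plane :=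
  (if ‖x‖ ≤ r then (1 : ℝ) else r ^ 2 / ‖x‖ ^ 2) • x

/-- The gradient of `x / |x|²`. -/
def dipole (x : Plane) (i j : Fin 2) : ℝ :=
  (if i = j then 1 else 0) / ‖x‖ ^ 2 - 2 * x i * x j / (‖x‖ ^ 2) ^ 2

/-- The gradient of `cutField r`. -/
def cutGrad (r : ℝ) (x : Plane) (i j : Fin 2) : ℝ :=
  if ‖x‖ ≤ r then (if i = j then 1 else 0) else r ^ 2 * dipole x i j

/-- The Lipschitz bound yields the weak gradient through the almost everywhere derivative, so the
kink at `|x| = r` needs no separate treatment. -/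
lemma norm_sub_cutField_le {r : ℝ} (hr : 0 < r) (x y : Plane) :
    ‖cutField r x - cutField r y‖ ≤ ‖x - y‖ := by
  have out : ∀ z : Plane, ¬ ‖z‖ ≤ r → 0 < r ^ 2 / ‖z‖ ^ 2 ∧ r ^ 2 / ‖z‖ ^ 2 ≤ 1 ∧
      r ^ 2 / ‖z‖ ^ 2 * ‖z‖ ^ 2 = r ^ 2 := by
    intro z hz
    have h1 : r < ‖z‖ := not_le.1 hz
    have h2 : 0 < ‖z‖ := hr.trans h1
    refine ⟨by positivity, ?_, by field_simp⟩
    rw [div_le_one (by positivity)]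
    gcongr
  have mixed : ∀ x y : Plane, ‖x‖ ≤ r → ¬ ‖y‖ ≤ r →
      ‖x - (r ^ 2 / ‖y‖ ^ 2) • y‖ ^ 2 ≤ ‖x - y‖ ^ 2 := by
    intro x y hx hy
    obtain ⟨h1, h2, h3⟩ := out y hy
    set k := r ^ 2 / ‖y‖ ^ 2
    rw [norm_sub_sq_real, norm_sub_sq_real, inner_smul_right, norm_smul, Real.norm_eq_abs,
      abs_of_pos h1]
    have h4 : inner ℝ x y ≤ r * ‖y‖ :=
      (real_inner_le_norm x y).trans (by gcongr)
    have h5 : (k * ‖y‖) * ‖y‖ = r ^ 2 := by rw [← h3]; ring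
    have hy0 : 0 < ‖y‖ := hr.trans (not_le.1 hy)
    -- After division by `1 - k`, the mixed case asks for `2⟨x, y⟩ ≤ (1 + k)|y|²`. Since `k|y|² =
    -- r²`, this follows from `2r|y| ≤ r² + |y|²`.
    have h6 : 2 * r ≤ (1 + k) * ‖y‖ := by
      have : 2 * r * ‖y‖ ≤ ((1 + k) * ‖y‖) * ‖y‖ := by nlinarith [sq_nonneg (r - ‖y‖)]
      exact le_of_mul_le_mul_right this hy0
    have h7 : 2 * (inner ℝ x y) ≤ (1 + k) * ‖y‖ * ‖y‖ := by nlinarith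
    nlinarith
  refine le_of_sq_le_sq ?_ (norm_nonneg _)
  unfold cutField
  by_cases hx : ‖x‖ ≤ r <;> by_cases hy : ‖y‖ ≤ r
  · simp [hx, hy]
  · simpa [hx, hy] using mixed x y hx hy
  · rw [norm_sub_rev, norm_sub_rev x y]
    simpa [hx, hy] using mixed y x hy hx
  · simp only [hx, hy, if_false]
    obtain ⟨h1, h2, h3⟩ := out x hx
    obtain ⟨k1, k2, k3⟩ := out y hy
    set k := r ^ 2 / ‖x‖ ^ 2
    set l := r ^ 2 / ‖y‖ ^ 2
    -- The distance identity for inversion; both factors `k`, `l` are at most 1 outside the disc.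
    have e : ‖k • x - l • y‖ ^ 2 = k * l * ‖x - y‖ ^ 2 := by
      rw [norm_sub_sq_real, norm_sub_sq_real, inner_smul_right, real_inner_smul_left, norm_smul,
        norm_smul, Real.norm_eq_abs, abs_of_pos h1, Real.norm_eq_abs, abs_of_pos k1]
      linear_combination (k - l) * (h3 - k3)
    rw [e]
    nlinarith [sq_nonneg ‖x - y‖, mul_le_one₀ h2 k1.le k2]

lemma lipschitzWith_cutField {r : ℝ} (hr : 0 < r) (i : Fin 2) :
    LipschitzWith 1 (fun x => cutField r x i) := by
  refine LipschitzWith.of_dist_le_mul fun x y => ?_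
  rw [NNReal.coe_one, one_mul, dist_eq_norm, dist_eq_norm]
  refine le_trans ?_ (norm_sub_cutField_le hr x y)
  exact PiLp.norm_apply_le (cutField r x - cutField r y) i

lemma norm_sq_add_smul_single (x : Plane) (t : ℝ) (j : Fin 2) :
    ‖x + t • (EuclideanSpace.single j 1 : Plane)‖ ^ 2 = ‖x‖ ^ 2 + 2 * t * x j + t ^ 2 := by
  rw [norm_add_sq_real, inner_smul_right, norm_smul]
  simp [EuclideanSpace.inner_single_right]
  ring

lemma ae_norm_ne (r : ℝ) : ∀ᵐ x : Plane, ‖x‖ ≠ r := by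
  have := Measure.addHaar_sphere (volume : Measure Plane) 0 r
  rw [ae_iff]
  convert this using 2
  ext x; simp

lemma lineDeriv_cutField {r : ℝ} (hr : 0 < r) {x : Plane} (hx : ‖x‖ ≠ r) (i j : Fin 2) :
    lineDeriv ℝ (fun x => cutField r x i) x (EuclideanSpace.single j 1) = cutGrad r x i j := by
  have hcont : Filter.Tendsto (fun t : ℝ => ‖x + t • (EuclideanSpace.single j 1 : Plane)‖)
      (nhds 0) (nhds ‖x‖) := by
    have : Continuous (fun t : ℝ => ‖x + t • (EuclideanSpace.single j 1 : Plane)‖) := by fun_prop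
    simpa using this.tendsto 0
  have hcoord : ∀ t : ℝ, (x + t • (EuclideanSpace.single j 1 : Plane)) i
      = x i + t * (if i = j then 1 else 0) := by
    intro t
    simp
  have hlin : HasDerivAt (fun t : ℝ => x i + t * (if i = j then (1 : ℝ) else 0))
      (if i = j then 1 else 0) 0 := by
    simpa using ((hasDerivAt_id (0 : ℝ)).mul_const (if i = j then (1 : ℝ) else 0)).const_add (x i)
  refine HasLineDerivAt.lineDeriv ?_
  unfold HasLineDerivAt
  rcases lt_or_gt_of_ne hx with h | h
  · have hc : cutGrad r x i j = if i = j then 1 else 0 := by simp [cutGrad, h.le]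
    rw [hc]
    refine hlin.congr_of_eventuallyEq ?_
    filter_upwards [hcont.eventually (gt_mem_nhds h)] with t ht
    simp only [cutField, ht.le, if_true, one_smul]
    exact hcoord t
  · have hc : cutGrad r x i j = r ^ 2 * dipole x i j := by simp [cutGrad, not_le.2 h]
    have hx0 : ‖x‖ ^ 2 ≠ 0 := by have := hr.trans h; positivity
    have hsq : HasDerivAt (fun t : ℝ => ‖x‖ ^ 2 + 2 * t * x j + t ^ 2) (2 * x j) 0 := by
      have h1 := (((hasDerivAt_id (0 : ℝ)).const_mul 2).mul_const (x j)).const_add (‖x‖ ^ 2)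
      refine (h1.add ((hasDerivAt_id (0 : ℝ)).pow 2)).congr_deriv ?_
      simp
    have hq := (((hasDerivAt_const (0 : ℝ) (r ^ 2)).div hsq (by simpa using hx0)).mul hlin)
    rw [hc]
    refine HasDerivAt.congr_of_eventuallyEq (hq.congr_deriv ?_) ?_
    · have hx1 : ‖x‖ ≠ 0 := by rintro h0; simp [h0] at hx0
      simp only [dipole, Pi.div_apply]
      split_ifs <;> field_simp <;> ring
    · filter_upwards [hcont.eventually (lt_mem_nhds h)] with t ht
      simp only [cutField, not_le.2 ht, if_false]
      rw [PiLp.smul_apply, hcoord, norm_sq_add_smul_single]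
      rfl

lemma hasH1LocGrad_cutField {r : ℝ} (hr : 0 < r) :
    HasH1LocGrad (fun x => position (cutField r x)) (fun x i j => (cutGrad r x i j : ℂ)) :=
  hasH1LocGrad_of_lipschitz (f := fun x i => cutField r x i) (lipschitzWith_cutField hr)
    fun i j => by
      filter_upwards [ae_norm_ne r] with x hx
      exact lineDeriv_cutField hr hx i j

lemma hasH1LocGrad_position :
    HasH1LocGrad position (fun _ i j => kron i j) := by
  have := hasH1LocGrad_of_lipschitz (f := fun x i => x i) (C := 1)
    (g := fun _ i j => if i = j then 1 else 0)
    (fun i => LipschitzWith.of_dist_le_mul fun x y => by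
      rw [NNReal.coe_one, one_mul, dist_eq_norm, dist_eq_norm]
      exact PiLp.norm_apply_le (x - y) i)
    (fun i j => Filter.Eventually.of_forall fun x => by
      refine HasLineDerivAt.lineDeriv ?_
      unfold HasLineDerivAt
      have hcoord : ∀ t : ℝ, (x + t • (EuclideanSpace.single j 1 : Plane)) i
          = x i + t * (if i = j then 1 else 0) := by
        intro t
        simp
      simp only [hcoord]
      simpa using
        ((hasDerivAt_id (0 : ℝ)).mul_const (if i = j then (1 : ℝ) else 0)).const_add (x i))
  have e : (fun (_ : Plane) i j => kron i j) =
      fun (_ : Plane) i j => (((if i = j then 1 else 0 : ℝ)) : ℂ) := by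
    ext x i j
    unfold kron
    split_ifs <;> simp
  rw [e]
  exact this

/-! ### Layers -/

lemma radius_le {N : ℕ} {r : ℕ → ℝ} (hr : ∀ j, 1 ≤ j → j < N → r (j + 1) < r j) {a b : ℕ}
    (ha : 1 ≤ a) (hab : a ≤ b) (hb : b ≤ N) : r b ≤ r a := by
  induction b, hab using Nat.le_induction with
  | base => exact le_rfl
  | succ n hn ih => exact (hr n (ha.trans hn) hb).le.trans (ih (by omega))

lemma exists_mem_layer (N : ℕ) (r : ℕ → ℝ) (x : Plane) : ∃ j ≤ N, x ∈ layer N r j := by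
  classical
  -- The least such index is a layer of `x`; minimality gives the outer bound, so no ordering of the
  -- radii enters.
  let P : ℕ → Prop := fun j => j = N ∨ r (j + 1) < ‖x‖
  have hP : ∃ j, P j := ⟨N, Or.inl rfl⟩
  have hle : Nat.find hP ≤ N := Nat.find_min' hP (Or.inl rfl)
  refine ⟨Nat.find hP, hle, fun h1 => ?_, fun h => ?_⟩
  · have := Nat.find_min hP (m := Nat.find hP - 1) (by omega)
    simp only [P, not_or, not_lt] at this
    rw [Nat.sub_add_cancel h1] at this
    exact this.2
  · exact (Nat.find_spec hP).resolve_left h.ne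

/-- Turns the case splits in `cutField` and `cutGrad` into comparisons of indices, where `k : Fin N`
stands for the interface of radius `r (k + 1)`. -/
lemma norm_le_radius_iff {N : ℕ} {r : ℕ → ℝ} (hr : ∀ j, 1 ≤ j → j < N → r (j + 1) < r j)
    {j : ℕ} (hj : j ≤ N) {x : Plane} (hx : x ∈ layer N r j) (k : Fin N) :
    ‖x‖ ≤ r (k + 1) ↔ (k : ℕ) < j := by
  refine ⟨fun h => ?_, fun h => ?_⟩
  · by_contra hk
    have := hx.2 (by omega)
    exact absurd (this.trans_le h) (not_lt.2 (radius_le hr (by omega) (by omega) k.2))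
  · exact (hx.1 (by omega)).trans (radius_le hr (by omega) (by omega) hj)

lemma epsField_eq {N : ℕ} {r : ℕ → ℝ} (hr : ∀ j, 1 ≤ j → j < N → r (j + 1) < r j)
    (ε : ℕ → ℂ) {j : ℕ} (hj : j ≤ N) {x : Plane} (hx : x ∈ layer N r j) :
    epsField N r ε x = ε j := by
  unfold epsField
  rw [Finset.sum_eq_single_of_mem j (by simp; omega), Set.indicator_of_mem hx]
  intro i hi hij
  refine Set.indicator_of_notMem (fun hi' => hij ?_) _
  have hiN : i ≤ N := by simp at hi; omega
  -- Disjointness of the layers: a point of both lies inside the same circles, which forces `i = j`.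
  have h : ∀ k : ℕ, k < N → (k < i ↔ k < j) := fun k hk =>
    (norm_le_radius_iff hr hiN hi' ⟨k, hk⟩).symm.trans (norm_le_radius_iff hr hj hx ⟨k, hk⟩)
  rcases lt_trichotomy i j with h1 | h1 | h1
  · exact absurd ((h i (by omega)).2 h1) (lt_irrefl _)
  · exact h1
  · exact absurd ((h j (by omega)).1 h1) (lt_irrefl _)

/-! ### Layered radial fields -/

/-- The coefficient of `x` in layer `j`, when it jumps by `t k` between the layers `k`, `k + 1`. -/
def coefA {N : ℕ} (a₀ : ℂ) (t : Fin N → ℂ) (j : ℕ) : ℂ :=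
  a₀ + ∑ k : Fin N, if (k : ℕ) < j then t k else 0

/-- The coefficient of `x / |x|²` in layer `j` that makes the layered field continuous. -/
def coefB {N : ℕ} (r : ℕ → ℝ) (t : Fin N → ℂ) (j : ℕ) : ℂ :=
  ∑ k : Fin N, if (k : ℕ) < j then 0 else t k * (r (k + 1) : ℂ) ^ 2

lemma coefA_zero {N : ℕ} (a₀ : ℂ) (t : Fin N → ℂ) : coefA a₀ t 0 = a₀ := by simp [coefA]

lemma coefB_last {N : ℕ} (r : ℕ → ℝ) (t : Fin N → ℂ) : coefB r t N = 0 := by simp [coefB]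

lemma coefB_zero {N : ℕ} (r : ℕ → ℝ) (t : Fin N → ℂ) :
    coefB r t 0 = ∑ k : Fin N, t k * (r (k + 1) : ℂ) ^ 2 := by simp [coefB]

lemma coefA_succ {N : ℕ} (a₀ : ℂ) (t : Fin N → ℂ) (k : Fin N) :
    coefA a₀ t (k + 1) = coefA a₀ t k + t k := by
  have : ∀ i : Fin N, (if (i : ℕ) < k + 1 then t i else 0)
      = (if (i : ℕ) < k then t i else 0) + if i = k then t i else 0 := by
    intro i
    rcases lt_trichotomy i k with h | h | h
    · have h' : (i : ℕ) < k := h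
      simp [h.ne, h', h'.trans (Nat.lt_succ_self _)]
    · simp [h]
    · have h' : (k : ℕ) < i := h
      simp [h.ne', not_lt.2 h'.le, not_lt.2 (Nat.succ_le_of_lt h')]
  simp only [coefA, this, Finset.sum_add_distrib, Finset.sum_ite_eq', Finset.mem_univ, if_true]
  ring

lemma coefB_succ {N : ℕ} (r : ℕ → ℝ) (t : Fin N → ℂ) (k : Fin N) :
    coefB r t k = coefB r t (k + 1) + t k * (r (k + 1) : ℂ) ^ 2 := by
  have : ∀ i : Fin N, (if (i : ℕ) < k then 0 else t i * (r (i + 1) : ℂ) ^ 2)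
      = (if (i : ℕ) < k + 1 then 0 else t i * (r (i + 1) : ℂ) ^ 2)
        + if i = k then t i * (r (i + 1) : ℂ) ^ 2 else 0 := by
    intro i
    rcases lt_trichotomy i k with h | h | h
    · have h' : (i : ℕ) < k := h
      simp [h.ne, h', h'.trans (Nat.lt_succ_self _)]
    · simp [h]
    · have h' : (k : ℕ) < i := h
      simp [h.ne', not_lt.2 h'.le, not_lt.2 (Nat.succ_le_of_lt h')]
  simp only [coefB, this, Finset.sum_add_distrib, Finset.sum_ite_eq', Finset.mem_univ, if_true]

/-- The coefficients of a layered field are determined by their transmission conditions. -/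
lemma coefA_eq {N : ℕ} {t : Fin N → ℂ} {a : ℕ → ℂ} (h : ∀ k : Fin N, a (k + 1) = a k + t k)
    {j : ℕ} (hj : j ≤ N) : coefA (a 0) t j = a j := by
  induction j with
  | zero => exact coefA_zero _ _
  | succ n ih => rw [coefA_succ (a 0) t ⟨n, hj⟩, ih (by omega), h ⟨n, hj⟩]

lemma coefB_eq {N : ℕ} {r : ℕ → ℝ} {t : Fin N → ℂ} {b : ℕ → ℂ} (hN : b N = 0)
    (h : ∀ k : Fin N, b k = b (k + 1) + t k * (r (k + 1) : ℂ) ^ 2)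
    {j : ℕ} (hj : j ≤ N) : coefB r t j = b j := by
  induction hj using Nat.decreasingInduction with
  | self => rw [coefB_last, hN]
  | of_succ n hn ih => rw [coefB_succ r t ⟨n, hn⟩, ih, h ⟨n, hn⟩]

/-- The continuous field `a₀ x + ∑ₖ tₖ min(1, rₖ² / |x|²) x`. -/
def layeredField {N : ℕ} (r : ℕ → ℝ) (a₀ : ℂ) (t : Fin N → ℂ) (x : Plane) : CVec :=
  a₀ • position x + ∑ k : Fin N, t k • position (cutField (r (k + 1)) x)

/-- The gradient of `layeredField`. -/
def layeredGrad {N : ℕ} (r : ℕ → ℝ) (a₀ : ℂ) (t : Fin N → ℂ) (x : Plane) (i j : Fin 2) : ℂ :=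
  a₀ * kron i j + ∑ k : Fin N, t k * (cutGrad (r (k + 1)) x i j : ℂ)

lemma hasH1LocGrad_layeredField {N : ℕ} {r : ℕ → ℝ} (hr : ∀ j, 1 ≤ j → j ≤ N → 0 < r j) (a₀ : ℂ)
    (t : Fin N → ℂ) : HasH1LocGrad (layeredField r a₀ t) (layeredGrad r a₀ t) := by
  have h0 : HasH1LocGrad (fun _ => 0) (fun _ _ _ => 0) :=
    ⟨fun i => isL2Loc_of_continuous continuous_const,
      fun i j => isL2Loc_of_continuous continuous_const, fun i j φ _ => by simp⟩
  have h1 := (h0.add_smul hasH1LocGrad_position a₀)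
  have h2 := h1.add_sum Finset.univ t
    (fun k => hasH1LocGrad_cutField (hr (k + 1) (by omega) k.2))
  simpa [layeredField, layeredGrad] using! h2

lemma position_smul (c : ℝ) (x : Plane) : position (c • x) = (c : ℂ) • position x := by
  ext i; simp [position]

lemma layeredField_eq {N : ℕ} {r : ℕ → ℝ} (hr : ∀ j, 1 ≤ j → j < N → r (j + 1) < r j)
    (a₀ : ℂ) (t : Fin N → ℂ) {j : ℕ} (hj : j ≤ N) {x : Plane} (hx : x ∈ layer N r j) :
    layeredField r a₀ t x = (coefA a₀ t j + coefB r t j / (‖x‖ : ℂ) ^ 2) • position x := by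
  simp only [layeredField, cutField, norm_le_radius_iff hr hj hx, position_smul, smul_smul,
    ← Finset.sum_smul, ← add_smul]
  congr 1
  rw [coefA, coefB, Finset.sum_div, add_assoc, ← Finset.sum_add_distrib]
  congr 1
  refine Finset.sum_congr rfl fun k _ => ?_
  split_ifs <;> simp [mul_div_assoc]

lemma layeredGrad_eq {N : ℕ} {r : ℕ → ℝ} (hr : ∀ j, 1 ≤ j → j < N → r (j + 1) < r j)
    (a₀ : ℂ) (t : Fin N → ℂ) {j : ℕ} (hj : j ≤ N) {x : Plane} (hx : x ∈ layer N r j)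
    (i l : Fin 2) :
    layeredGrad r a₀ t x i l = coefA a₀ t j * kron i l + coefB r t j * (dipole x i l : ℂ) := by
  simp only [layeredGrad, cutGrad, norm_le_radius_iff hr hj hx]
  rw [coefA, coefB, add_mul, add_assoc, Finset.sum_mul, Finset.sum_mul, ← Finset.sum_add_distrib]
  congr 1
  refine Finset.sum_congr rfl fun k _ => ?_
  split_ifs <;> simp_all [kron, mul_assoc]

/-! ### The stress of layered fields -/

lemma sum_elasticTensor (lam mu : ℂ) (G : Fin 2 → Fin 2 → ℂ) (i j : Fin 2) :
    ∑ k, ∑ l, elasticTensor lam mu i j k l * symPart G k l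
      = lam * (G 0 0 + G 1 1) * kron i j + mu * (G i j + G j i) := by
  fin_cases i <;> fin_cases j <;>
    simp [Fin.sum_univ_two, elasticTensor, symPart, kron] <;> ring

lemma norm_sq_eq (x : Plane) : ‖x‖ ^ 2 = x 0 ^ 2 + x 1 ^ 2 := by
  simp [EuclideanSpace.norm_sq_eq, Fin.sum_univ_two]

lemma dipole_symm (x : Plane) (i j : Fin 2) : dipole x i j = dipole x j i := by
  simp only [dipole, eq_comm (a := i)]
  ring

lemma dipole_trace (x : Plane) : dipole x 0 0 + dipole x 1 1 = 0 := by
  by_cases h : ‖x‖ ^ 2 = 0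
  · simp [dipole, h]
  · simp only [dipole, if_true]
    field_simp
    rw [norm_sq_eq]
    ring

/-- The stress of the gradient `a I + b ∇(x / |x|²)`. -/
lemma sum_elasticTensor_dipole (e : ℂ) (lam mu : ℝ) (a b : ℂ) {G : Fin 2 → Fin 2 → ℂ} {x : Plane}
    (hG : ∀ i j, G i j = a * kron i j + b * (dipole x i j : ℂ)) (i j : Fin 2) :
    ∑ k, ∑ l, elasticTensor (e * lam) (e * mu) i j k l * symPart G k l
      = 2 * (lam + mu) * (e * a) * kron i j + 2 * mu * (e * b) * (dipole x i j : ℂ) := by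
  have ht : (dipole x 0 0 : ℂ) + (dipole x 1 1 : ℂ) = 0 := by
    exact_mod_cast dipole_trace x
  have hk : kron j i = kron i j := by simp [kron, eq_comm]
  have h0 : kron 0 0 = 1 := by simp [kron]
  have h1 : kron 1 1 = 1 := by simp [kron]
  rw [sum_elasticTensor, hG, hG, hG, hG, dipole_symm x j i, hk, h0, h1]
  linear_combination e * lam * b * kron i j * ht

/-- The two dimensional cofactor matrix of a gradient is weakly divergence free. -/
lemma HasH1LocGrad.integral_cofactor {u : Plane → CVec} {G : Plane → Fin 2 → Fin 2 → ℂ}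
    (hu : HasH1LocGrad u G) {φ : Fin 2 → Plane → ℝ} (hφ : ∀ i, IsTest (φ i)) :
    ∫ x, ∑ i, ∑ j, ((G x 0 0 + G x 1 1) * kron i j - G x j i) * (partialDeriv (φ i) j x : ℂ)
      = 0 := by
  have hi : ∀ i j k l, Integrable (fun x => G x i j * (partialDeriv (φ k) l x : ℂ)) :=
    fun i j k l => (hu.l2_grad i j).integrable_mul ((hφ k).partialDeriv l)
  have e : ∀ x, ∑ i, ∑ j, ((G x 0 0 + G x 1 1) * kron i j - G x j i)
        * (partialDeriv (φ i) j x : ℂ)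
      = (G x 1 1 * (partialDeriv (φ 0) 0 x : ℂ) - G x 1 0 * (partialDeriv (φ 0) 1 x : ℂ))
        + (G x 0 0 * (partialDeriv (φ 1) 1 x : ℂ) - G x 0 1 * (partialDeriv (φ 1) 0 x : ℂ)) := by
    intro x
    simp [Fin.sum_univ_two, kron]
    ring
  simp_rw [e]
  rw [integral_add (by exact (hi _ _ _ _).sub (hi _ _ _ _))
      (by exact (hi _ _ _ _).sub (hi _ _ _ _)), integral_sub (hi _ _ _ _) (hi _ _ _ _), integral_sub (hi _ _ _ _) (hi _ _ _ _),
    hu.integral_swap (hφ 0) 1 1 0, hu.integral_swap (hφ 1) 0 0 1]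
  ring

/-- Continuity of the normal stress at the interface `|x| = r_{k+1}`. -/
def FluxCondition {N : ℕ} (r : ℕ → ℝ) (lam mu : ℝ) (ε : ℕ → ℂ) (a b : ℕ → ℂ) (k : Fin N) : Prop :=
  ε k * ((lam + mu) * a k - mu * b k / (r (k + 1) : ℂ) ^ 2)
    = ε (k + 1) * ((lam + mu) * a (k + 1) - mu * b (k + 1) / (r (k + 1) : ℂ) ^ 2)

/-- Under the flux conditions the stress of a layered field is the cofactor matrix of the gradient
of another layered field. -/
lemma exists_stress_eq_cofactor {N : ℕ} {r : ℕ → ℝ} (hr0 : ∀ j, 1 ≤ j → j ≤ N → 0 < r j)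
    (hr : ∀ j, 1 ≤ j → j < N → r (j + 1) < r j) (lam mu : ℝ) (ε : ℕ → ℂ) (a₀ : ℂ)
    (t : Fin N → ℂ) (hflux : ∀ k : Fin N, FluxCondition r lam mu ε (coefA a₀ t) (coefB r t) k) :
    ∃ (A₀ : ℂ) (τ : Fin N → ℂ), ∀ x i j,
      ∑ k, ∑ l, elasticTensor (epsField N r ε x * lam) (epsField N r ε x * mu) i j k l
          * symPart (layeredGrad r a₀ t x) k l
        = (layeredGrad r A₀ τ x 0 0 + layeredGrad r A₀ τ x 1 1) * kron i j
          - layeredGrad r A₀ τ x j i := by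
  -- The dipole matrix is symmetric and trace free, so the cofactor of `a I + b ∇(x/|x|²)` is `a I -
  -- b ∇(x/|x|²)`. Matching this with the stress gives `A` and the minus sign in `B`.
  set A : ℕ → ℂ := fun j => 2 * (lam + mu) * (ε j * coefA a₀ t j)
  set B : ℕ → ℂ := fun j => -(2 * mu * (ε j * coefB r t j))
  set τ : Fin N → ℂ := fun k => A (k + 1) - A k
  have hA : ∀ j ≤ N, coefA (A 0) τ j = A j := fun j hj => coefA_eq (fun k => by simp [τ]) hj
  -- Continuity of the second field at `r (k + 1)` is twice the flux condition there.
  have hB : ∀ j ≤ N, coefB r τ j = B j := fun j hj =>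
    coefB_eq (by simp [B, coefB_last]) (fun k => by
      have h := hflux k
      have hk : (r (k + 1) : ℂ) ≠ 0 := by
        exact_mod_cast (hr0 (k + 1) (by omega) k.2).ne'
      unfold FluxCondition at h
      field_simp at h
      simp only [τ, A, B]
      linear_combination 2 * h) hj
  refine ⟨A 0, τ, fun x i l => ?_⟩
  obtain ⟨j, hj, hx⟩ := exists_mem_layer N r x
  rw [epsField_eq hr ε hj hx,
    sum_elasticTensor_dipole (ε j) lam mu _ _ (layeredGrad_eq hr a₀ t hj hx)]
  simp only [layeredGrad_eq hr _ _ hj hx, hA j hj, hB j hj]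
  have ht : (dipole x 0 0 : ℂ) + (dipole x 1 1 : ℂ) = 0 := by
    exact_mod_cast dipole_trace x
  have hk : kron l i = kron i l := by simp [kron, eq_comm]
  have h0 : kron 0 0 = 1 := by simp [kron]
  have h1 : kron 1 1 = 1 := by simp [kron]
  rw [dipole_symm x l i, hk, h0, h1]
  simp only [A, B]
  linear_combination (2 * mu * (ε j * coefB r t j) * kron i l) * ht

/-- No integrability of `f` is needed: if `f` is not integrable, neither is `f + g`, whose integral
is then 0 by convention. This serves a weak solution whose stress pairing is not known to be
integrable. -/
lemma integral_add_eq_zero {f g : Plane → ℂ} (hg : Integrable g) (hf0 : ∫ x, f x = 0)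
    (hg0 : ∫ x, g x = 0) : ∫ x, (f x + g x) = 0 := by
  by_cases hf : Integrable f
  · rw [integral_add hf hg, hf0, hg0, add_zero]
  · refine integral_undef fun h => hf ?_
    exact (h.sub hg).congr (Filter.Eventually.of_forall fun x => add_sub_cancel_right _ _)

/-- A layered field satisfying the flux conditions can be added to any weak solution. -/
lemma IsWeakLame.add_layeredGrad {N : ℕ} {r : ℕ → ℝ} (hr0 : ∀ j, 1 ≤ j → j ≤ N → 0 < r j)
    (hr : ∀ j, 1 ≤ j → j < N → r (j + 1) < r j) {lam mu : ℝ} {ε : ℕ → ℂ} (a₀ : ℂ)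
    (t : Fin N → ℂ) (hflux : ∀ k : Fin N, FluxCondition r lam mu ε (coefA a₀ t) (coefB r t) k)
    {G : Plane → Fin 2 → Fin 2 → ℂ} (hG : IsWeakLame (epsField N r ε) lam mu G) :
    IsWeakLame (epsField N r ε) lam mu (fun x i j => G x i j + layeredGrad r a₀ t x i j) := by
  intro φ hφ
  obtain ⟨A₀, τ, hτ⟩ := exists_stress_eq_cofactor hr0 hr lam mu ε a₀ t hflux
  have hu := hasH1LocGrad_layeredField hr0 A₀ τ
  have e : ∀ x, ∑ i, ∑ j, (∑ k, ∑ l, elasticTensor (epsField N r ε x * lam)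
          (epsField N r ε x * mu) i j k l
            * symPart (fun i j => G x i j + layeredGrad r a₀ t x i j) k l)
            * (partialDeriv (φ i) j x : ℂ)
      = (∑ i, ∑ j, (∑ k, ∑ l, elasticTensor (epsField N r ε x * lam)
          (epsField N r ε x * mu) i j k l * symPart (G x) k l) * (partialDeriv (φ i) j x : ℂ))
        + ∑ i, ∑ j, ((layeredGrad r A₀ τ x 0 0 + layeredGrad r A₀ τ x 1 1) * kron i j
          - layeredGrad r A₀ τ x j i) * (partialDeriv (φ i) j x : ℂ) := by
    intro x
    simp only [← hτ, ← Finset.sum_add_distrib, ← add_mul, ← mul_add]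
    refine Finset.sum_congr rfl fun i _ => Finset.sum_congr rfl fun j _ => ?_
    congr 1
    refine Finset.sum_congr rfl fun k _ => Finset.sum_congr rfl fun l _ => ?_
    simp only [symPart]
    ring
  have hint : Integrable (fun x =>
      ∑ i, ∑ j, ((layeredGrad r A₀ τ x 0 0 + layeredGrad r A₀ τ x 1 1) * kron i j
          - layeredGrad r A₀ τ x j i) * (partialDeriv (φ i) j x : ℂ)) := by
    refine integrable_finsetSum _ fun i _ => integrable_finsetSum _ fun j _ => ?_
    have h : ∀ k l, Integrable
        (fun x => layeredGrad r A₀ τ x k l * (partialDeriv (φ i) j x : ℂ)) :=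
      fun k l => (hu.l2_grad k l).integrable_mul ((hφ i).partialDeriv j)
    refine ((((h 0 0).add (h 1 1)).const_mul (kron i j)).sub (h j i)).congr
      (Filter.Eventually.of_forall fun x => ?_)
    simp only [Pi.sub_apply, Pi.add_apply]
    ring
  simp_rw [e]
  exact integral_add_eq_zero hint (hG φ hφ) (hu.integral_cofactor hφ)

lemma isWeakLame_layeredGrad {N : ℕ} {r : ℕ → ℝ} (hr0 : ∀ j, 1 ≤ j → j ≤ N → 0 < r j)
    (hr : ∀ j, 1 ≤ j → j < N → r (j + 1) < r j) {lam mu : ℝ} {ε : ℕ → ℂ} (a₀ : ℂ)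
    (t : Fin N → ℂ) (hflux : ∀ k : Fin N, FluxCondition r lam mu ε (coefA a₀ t) (coefB r t) k) :
    IsWeakLame (epsField N r ε) lam mu (layeredGrad r a₀ t) := by
  have h0 : IsWeakLame (epsField N r ε) lam mu (fun _ _ _ => 0) := fun φ _ => by simp [symPart]
  simpa using! h0.add_layeredGrad hr0 hr a₀ t hflux

/-! ### The momentum matrix -/

/-- In column `k` of the matrix the entries `-1` above the diagonal sum the jumps of outer
interfaces into `coefA`; those below it, with the ratios of radii, sum the inner ones into `coefB`.
-/
lemma momentumMatrix_transpose_mulVec {N : ℕ} {r : ℕ → ℝ} (lam mu : ℝ) (ε : ℕ → ℂ) (a₀ : ℂ)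
    (t : Fin N → ℂ) (k : Fin N) :
    (momentumMatrix N r lam mu ε).transpose.mulVec t k
      = betaT lam mu ε (k + 1) * t k - (coefA a₀ t k - a₀)
        + (mu / (lam + mu)) * coefB r t (k + 1) / (r (k + 1) : ℂ) ^ 2 := by
  have e : ∀ i : Fin N, momentumMatrix N r lam mu ε i k * t i
      = (if i = k then betaT lam mu ε (k + 1) * t k else 0) - (if (i : ℕ) < k then t i else 0)
        + (mu / (lam + mu)) * (if (i : ℕ) < k + 1 then 0 else t i * (r (i + 1) : ℂ) ^ 2)
          / (r (k + 1) : ℂ) ^ 2 := by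
    intro i
    rcases lt_trichotomy i k with h | h | h
    · have h' : (i : ℕ) < k := h
      simp [momentumMatrix, h.ne, h, h'.trans (Nat.lt_succ_self _)]
    · simp [momentumMatrix, h]
    · have h' : (k : ℕ) < i := h
      simp [momentumMatrix, h.ne', not_lt.2 h.le, not_lt.2 (Nat.succ_le_of_lt h')]
      ring
  simp only [Matrix.mulVec, dotProduct, Matrix.transpose_apply, e, Finset.sum_add_distrib,
    Finset.sum_sub_distrib, Finset.sum_ite_eq', Finset.mem_univ, if_true, coefA, coefB,
    ← Finset.sum_div, ← Finset.mul_sum]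
  ring

/-- With `A_{k+1} = A_k + t_k` and `B_k = B_{k+1} + t_k r²`, the flux condition becomes `(ε_k -
ε_{k+1})((λ+μ)A_k - μ B_{k+1}/r²) = t_k (μ ε_k + (λ+μ) ε_{k+1})`. Dividing by `(λ+μ)(ε_k - ε_{k+1})`
produces `β̃_{k+1}`. -/
lemma fluxCondition_iff {N : ℕ} {r : ℕ → ℝ} (hr0 : ∀ j, 1 ≤ j → j ≤ N → 0 < r j)
    {lam mu : ℝ} (hconv : 0 < 2 * lam + 2 * mu) {ε : ℕ → ℂ}
    (hε : ∀ j, 1 ≤ j → j ≤ N → ε (j - 1) ≠ ε j) (a₀ : ℂ) (t : Fin N → ℂ) (k : Fin N) :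
    FluxCondition r lam mu ε (coefA a₀ t) (coefB r t) k ↔
      (momentumMatrix N r lam mu ε).transpose.mulVec t k = a₀ := by
  have hs : (r (k + 1) : ℂ) ≠ 0 := by
    exact_mod_cast (hr0 (k + 1) (by omega) k.2).ne'
  have hl : (lam : ℂ) + mu ≠ 0 := by
    have : lam + mu ≠ 0 := by linarith
    exact_mod_cast this
  have he : ε k - ε (k + 1) ≠ 0 := sub_ne_zero.2 (by simpa using hε (k + 1) (by omega) k.2)
  rw [momentumMatrix_transpose_mulVec lam mu ε a₀, FluxCondition, coefA_succ, coefB_succ r t k,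
    betaT]
  push_cast [Nat.add_sub_cancel]
  constructor
  · intro h
    field_simp at h ⊢
    linear_combination -h
  · intro h
    field_simp at h ⊢
    linear_combination -h

/-! ### Solvability -/

lemma norm_position (x : Plane) : ‖position x‖ = ‖x‖ := by
  simp [EuclideanSpace.norm_eq, position]

lemma mem_layer_zero {N : ℕ} (hN : 1 ≤ N) {r : ℕ → ℝ} {x : Plane} :
    x ∈ layer N r 0 ↔ r 1 < ‖x‖ := by
  simp [layer, Nat.lt_of_lt_of_le Nat.zero_lt_one hN]

lemma layeredField_sub_background {N : ℕ} {r : ℕ → ℝ}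
    (hr : ∀ j, 1 ≤ j → j < N → r (j + 1) < r j) (a₀ : ℂ) (t : Fin N → ℂ)
    {x : Plane} (hx : x ∈ layer N r 0) :
    layeredField r a₀ t x - background a₀ x = (coefB r t 0 / (‖x‖ : ℂ) ^ 2) • position x := by
  rw [layeredField_eq hr a₀ t (Nat.zero_le N) hx, coefA_zero, background, ← sub_smul,
    add_sub_cancel_left]

lemma decaysTo_layeredField {N : ℕ} (hN : 1 ≤ N) {r : ℕ → ℝ}
    (hr0 : ∀ j, 1 ≤ j → j ≤ N → 0 < r j)
    (hr : ∀ j, 1 ≤ j → j < N → r (j + 1) < r j) (a₀ : ℂ) (t : Fin N → ℂ) :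
    DecaysTo (layeredField r a₀ t) (background a₀) := by
  have h1 := hr0 1 le_rfl hN
  refine ⟨‖coefB r t 0‖, r 1 + 1, by linarith, Filter.Eventually.of_forall fun x hx => ?_⟩
  have h2 : ‖x‖ ≠ 0 := by linarith
  rw [layeredField_sub_background hr a₀ t ((mem_layer_zero hN).2 (by linarith)), norm_smul,
    norm_position, norm_div, norm_pow, Complex.norm_real, norm_norm]
  apply le_of_eq
  field_simp

lemma DecaysTo.add_layeredField {N : ℕ} (hN : 1 ≤ N) {r : ℕ → ℝ}
    (hr0 : ∀ j, 1 ≤ j → j ≤ N → 0 < r j)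
    (hr : ∀ j, 1 ≤ j → j < N → r (j + 1) < r j) {u H : Plane → CVec} (hu : DecaysTo u H)
    (t : Fin N → ℂ) : DecaysTo (fun x => u x + layeredField r 0 t x) H := by
  obtain ⟨C, R, hR, h⟩ := hu
  obtain ⟨C', R', _, h'⟩ := decaysTo_layeredField hN hr0 hr 0 t
  refine ⟨C + C', max R R', lt_max_of_lt_left hR, ?_⟩
  filter_upwards [h, h'] with x hx hx' hmax
  have e1 := hx ((le_max_left _ _).trans hmax)
  have e2 := hx' ((le_max_right _ _).trans hmax)
  simp only [background, zero_smul, sub_zero] at e2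
  calc ‖u x + layeredField r 0 t x - H x‖ = ‖(u x - H x) + layeredField r 0 t x‖ := by
        congr 1; abel
    _ ≤ _ := (norm_add_le _ _).trans (by rw [add_mul]; exact add_le_add e1 e2)

lemma isSolution_layeredField {N : ℕ} (hN : 1 ≤ N) {r : ℕ → ℝ}
    (hr0 : ∀ j, 1 ≤ j → j ≤ N → 0 < r j) (hr : ∀ j, 1 ≤ j → j < N → r (j + 1) < r j)
    {lam mu : ℝ} {ε : ℕ → ℂ} {a₀ : ℂ} {t : Fin N → ℂ}
    (hflux : ∀ k : Fin N, FluxCondition r lam mu ε (coefA a₀ t) (coefB r t) k) :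
    IsSolution N r ε lam mu (background a₀) (layeredField r a₀ t) :=
  ⟨⟨_, hasH1LocGrad_layeredField hr0 a₀ t, isWeakLame_layeredGrad hr0 hr a₀ t hflux⟩,
    decaysTo_layeredField hN hr0 hr a₀ t⟩

lemma IsSolution.add_layeredField {N : ℕ} (hN : 1 ≤ N) {r : ℕ → ℝ}
    (hr0 : ∀ j, 1 ≤ j → j ≤ N → 0 < r j) (hr : ∀ j, 1 ≤ j → j < N → r (j + 1) < r j)
    {lam mu : ℝ} {ε : ℕ → ℂ} {H u : Plane → CVec} (hu : IsSolution N r ε lam mu H u)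
    {t : Fin N → ℂ}
    (hflux : ∀ k : Fin N, FluxCondition r lam mu ε (coefA 0 t) (coefB r t) k) :
    IsSolution N r ε lam mu H (fun x => u x + layeredField r 0 t x) := by
  obtain ⟨⟨G, hG, hw⟩, hd⟩ := hu
  refine ⟨⟨_, ?_, hw.add_layeredGrad hr0 hr 0 t hflux⟩, hd.add_layeredField hN hr0 hr t⟩
  simpa using hG.add_smul (hasH1LocGrad_layeredField hr0 0 t) 1

lemma isRadial_layeredField {N : ℕ} (r : ℕ → ℝ) (a₀ : ℂ) (t : Fin N → ℂ) :
    IsRadial (layeredField r a₀ t) := by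
  refine ⟨fun s => a₀ + ∑ k : Fin N, t k *
    ((if s ≤ r (k + 1) then (1 : ℝ) else r (k + 1) ^ 2 / s ^ 2 : ℝ) : ℂ),
    Filter.Eventually.of_forall fun x => ?_⟩
  simp only [layeredField, cutField, position_smul, add_smul, Finset.sum_smul, mul_smul]

lemma continuous_layeredField {N : ℕ} {r : ℕ → ℝ} (hr0 : ∀ j, 1 ≤ j → j ≤ N → 0 < r j)
    (a₀ : ℂ) (t : Fin N → ℂ) : Continuous (layeredField r a₀ t) := by
  have hp : Continuous position :=
    (PiLp.continuous_toLp 2 _).comp (continuous_pi fun i => by fun_prop)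
  have hc : ∀ k : Fin N, Continuous (cutField (r (k + 1))) := fun k =>
    LipschitzWith.continuous (K := 1) (LipschitzWith.of_dist_le_mul fun x y => by
      rw [NNReal.coe_one, one_mul, dist_eq_norm, dist_eq_norm]
      exact norm_sub_cutField_le (hr0 (k + 1) (by omega) k.2) x y)
  unfold layeredField
  fun_prop

lemma norm_single_of_pos {s : ℝ} (hs : 0 < s) : ‖(EuclideanSpace.single 0 s : Plane)‖ = s := by
  simp [abs_of_pos hs]

lemma exists_mem_layer_of_lt {N : ℕ} {r : ℕ → ℝ} (hr0 : ∀ j, 1 ≤ j → j ≤ N → 0 < r j)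
    (hr : ∀ j, 1 ≤ j → j < N → r (j + 1) < r j) {j : ℕ} (hj : j < N) :
    ∃ x ∈ layer N r j, x ≠ 0 ∧ r (j + 1) < ‖x‖ := by
  have h1 := hr0 (j + 1) (by omega) hj
  rcases Nat.eq_zero_or_pos j with rfl | h
  · refine ⟨EuclideanSpace.single 0 (r 1 + 1), ?_⟩
    have hn : ‖(EuclideanSpace.single 0 (r 1 + 1) : Plane)‖ = r 1 + 1 := norm_single_of_pos (by simp at h1; linarith)
    refine ⟨⟨by omega, fun _ => ?_⟩, ?_, ?_⟩
    · simp [hn]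
    · rw [← norm_ne_zero_iff, hn]; simp at h1; linarith
    · simp [hn]
  · refine ⟨EuclideanSpace.single 0 (r j), ?_⟩
    have h2 := hr j h hj
    have hn : ‖(EuclideanSpace.single 0 (r j) : Plane)‖ = r j := norm_single_of_pos (by linarith)
    refine ⟨⟨fun _ => hn.le, fun _ => ?_⟩, ?_, ?_⟩
    · rwa [hn]
    · rw [← norm_ne_zero_iff, hn]; linarith
    · rwa [hn]

/-- Continuity upgrades almost everywhere to everywhere, so single points can be sampled. The
coefficients vanish from the core outwards: once they vanish in layer `n + 1`, the field in layer
`n` is `t_n (r_{n+1}²/|x|² - 1) x`, and a point with `|x| > r_{n+1}` gives `t_n = 0`. -/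
lemma layeredField_injective {N : ℕ} (hN : 1 ≤ N) {r : ℕ → ℝ} (hr0 : ∀ j, 1 ≤ j → j ≤ N → 0 < r j)
    (hr : ∀ j, 1 ≤ j → j < N → r (j + 1) < r j) {t : Fin N → ℂ}
    (h : layeredField r 0 t =ᵐ[volume] 0) : t = 0 := by
  have hz : layeredField r 0 t = 0 :=
    (Continuous.ae_eq_iff_eq volume (continuous_layeredField hr0 0 t) continuous_const).1 h
  have h0 : coefA 0 t N = 0 := by
    have h1 := hr0 N hN le_rfl
    have hn : ‖(EuclideanSpace.single 0 (r N) : Plane)‖ = r N := norm_single_of_pos h1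
    have e := layeredField_eq hr 0 t le_rfl (x := EuclideanSpace.single 0 (r N))
      ⟨fun _ => hn.le, fun h => absurd h (lt_irrefl N)⟩
    rw [hz, Pi.zero_apply, eq_comm, smul_eq_zero, coefB_last, zero_div, add_zero] at e
    refine e.resolve_right ?_
    rw [← norm_eq_zero, norm_position, hn]
    exact h1.ne'
  have key : ∀ j ≤ N, coefA 0 t j = 0 ∧ coefB r t j = 0 := by
    intro j hj
    induction hj using Nat.decreasingInduction with
    | self => exact ⟨h0, coefB_last r t⟩
    | of_succ n hn ih =>
      obtain ⟨x, hx, hx0, hxr⟩ := exists_mem_layer_of_lt hr0 hr hn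
      have e1 := coefA_succ 0 t ⟨n, hn⟩
      have e2 := coefB_succ r t ⟨n, hn⟩
      rw [ih.1] at e1
      rw [ih.2] at e2
      have e3 := layeredField_eq hr 0 t hn.le hx
      rw [hz, Pi.zero_apply, eq_comm, smul_eq_zero] at e3
      have hp : position x ≠ 0 := by
        rw [← norm_ne_zero_iff, norm_position]; exact norm_ne_zero_iff.2 hx0
      have e4 := e3.resolve_right hp
      have e5 : coefA 0 t n = -t ⟨n, hn⟩ := by linear_combination -e1
      simp only [zero_add] at e2
      rw [e5, e2] at e4
      have hxn : (‖x‖ : ℂ) ≠ 0 := by exact_mod_cast norm_ne_zero_iff.2 hx0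
      field_simp at e4
      have e6 : t ⟨n, hn⟩ * ((r (n + 1) : ℂ) ^ 2 - (‖x‖ : ℂ) ^ 2) = 0 := by
        linear_combination e4
      have e7 : (r (n + 1) : ℂ) ^ 2 - (‖x‖ : ℂ) ^ 2 ≠ 0 := by
        have := hr0 (n + 1) (by omega) hn
        have : r (n + 1) ^ 2 - ‖x‖ ^ 2 ≠ 0 := by nlinarith
        exact_mod_cast this
      have e8 := (mul_eq_zero.1 e6).resolve_right e7
      rw [e5, e2, e8]
      simp
  ext k
  have := coefA_succ 0 t k
  rw [(key _ k.2).1, (key _ k.2.le).1] at this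
  simpa using this.symm

/-- The jumps `t` solving `P̃ᵀ t = a₀ e`. -/
lemma transpose_mulVec_eq_iff {N : ℕ} {P : Matrix (Fin N) (Fin N) ℂ} (hP : IsUnit P)
    (a₀ : ℂ) (t : Fin N → ℂ) :
    P.transpose.mulVec t = (fun _ => a₀) ↔ t = a₀ • (P.transpose⁻¹).mulVec (fun _ => 1) := by
  have hdet : IsUnit P.transpose.det := by
    rw [Matrix.det_transpose]; exact (Matrix.isUnit_iff_isUnit_det _).1 hP
  have e : (fun _ : Fin N => a₀) = a₀ • (fun _ => (1 : ℂ)) := by ext; simp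
  constructor
  · intro h
    rw [← Matrix.mulVec_smul, ← e, ← h, Matrix.mulVec_mulVec, Matrix.nonsing_inv_mul _ hdet,
      Matrix.one_mulVec]
  · rintro rfl
    rw [Matrix.mulVec_smul, Matrix.mulVec_mulVec, Matrix.mul_nonsing_inv _ hdet,
      Matrix.one_mulVec, ← e]

lemma hasRepresentation_layeredField {N : ℕ} {r : ℕ → ℝ}
    (hr : ∀ j, 1 ≤ j → j < N → r (j + 1) < r j) (lam mu : ℝ) (ε : ℕ → ℂ) (a₀ : ℂ) :
    HasRepresentation N r lam mu ε (background a₀) (layeredField r a₀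
      (a₀ • ((momentumMatrix N r lam mu ε).transpose⁻¹).mulVec (fun _ => 1))) := by
  refine Filter.Eventually.of_forall fun x hx => ?_
  rw [layeredField_sub_background hr _ _ hx, perturbation, background, smul_smul, smul_smul,
    coefB_zero, ← Matrix.mulVec_mulVec]
  congr 1
  simp only [radiiMatrix, Matrix.mulVec_diagonal, dotProduct, one_mul, Pi.smul_apply, smul_eq_mul]
  push_cast
  rw [div_eq_inv_mul, mul_assoc, Finset.sum_mul]
  congr 1
  exact Finset.sum_congr rfl fun k _ => by ring

lemma exists_kernel_of_not_isUnit {N : ℕ} {P : Matrix (Fin N) (Fin N) ℂ} (hP : ¬ IsUnit P) :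
    ∃ t : Fin N → ℂ, t ≠ 0 ∧ P.transpose.mulVec t = 0 := by
  refine Matrix.exists_mulVec_eq_zero_iff.2 ?_
  rw [Matrix.det_transpose]
  by_contra h
  exact hP ((Matrix.isUnit_iff_isUnit_det _).2 (isUnit_iff_ne_zero.2 h))

lemma HasRepresentation.congr {N : ℕ} {r : ℕ → ℝ} {lam mu : ℝ} {ε : ℕ → ℂ}
    {H u v : Plane → CVec} (hu : HasRepresentation N r lam mu ε H u) (h : v =ᵐ[volume] u) :
    HasRepresentation N r lam mu ε H v := by
  filter_upwards [hu, h] with x hx e hx0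
  rw [e, hx hx0]

end

/-! ### Weak solutions of `f' = 0` and `f'' = 0` on intervals -/

/-- A smooth function with compact support in `U` and zero mean has a primitive of the same kind. -/
lemma exists_primitive {U : Set ℝ} (hU : U.OrdConnected) {g : ℝ → ℝ} (hg : ContDiff ℝ ∞ g)
    (hc : HasCompactSupport g) (hs : tsupport g ⊆ U) (h0 : ∫ x, g x = 0) :
    ∃ χ : ℝ → ℝ, ContDiff ℝ ∞ χ ∧ HasCompactSupport χ ∧ tsupport χ ⊆ U ∧ deriv χ = g := by
  rcases (tsupport g).eq_empty_or_nonempty with he | hne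
  · have : g = 0 := tsupport_eq_empty_iff.1 he
    refine ⟨0, contDiff_const, HasCompactSupport.zero, ?_, ?_⟩
    · simp [tsupport_eq_empty_iff.2]
    · rw [this]; ext; simp
  have hp := hc.isCompact.sInf_mem hne
  have hq := hc.isCompact.sSup_mem hne
  set p := sInf (tsupport g)
  set q := sSup (tsupport g)
  have hsub : tsupport g ⊆ Set.Icc p q := fun x hx =>
    ⟨csInf_le hc.isCompact.bddBelow hx, le_csSup hc.isCompact.bddAbove hx⟩
  have hz : ∀ x, x ∉ Set.Icc p q → g x = 0 := fun x hx =>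
    image_eq_zero_of_notMem_tsupport fun h => hx (hsub h)
  -- The base point lies strictly left of the support, so that for `s > q` the half-open interval of
  -- integration contains the whole support, its left endpoint included.
  set χ : ℝ → ℝ := fun s => ∫ t in (p - 1)..s, g t
  have hd : ∀ s, HasDerivAt χ (g s) s := fun s =>
    intervalIntegral.integral_hasDerivAt_right (hg.continuous.intervalIntegrable _ _)
      (hg.continuous.stronglyMeasurableAtFilter _ _) hg.continuous.continuousAt
  have hderiv : deriv χ = g := funext fun s => (hd s).deriv
  have hsupp : Function.support χ ⊆ Set.Icc p q := by
    intro s hs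
    by_contra hns
    refine hs ?_
    by_cases h1 : p ≤ s
    · have h2 : q < s := by
        by_contra h; exact hns ⟨h1, not_lt.1 h⟩
      change ∫ t in (p - 1)..s, g t = 0
      rw [intervalIntegral.integral_eq_integral_of_support_subset, h0]
      intro x hx
      have : x ∈ Set.Icc p q := hsub (subset_tsupport _ hx)
      exact ⟨by linarith [this.1], this.2.trans h2.le⟩
    · change ∫ t in (p - 1)..s, g t = 0
      rw [intervalIntegral.integral_congr (g := fun _ => 0)]
      · simp
      · intro x hx
        refine hz x fun hx' => ?_
        rcases Set.mem_uIcc.1 hx with h | h <;> linarith [hx'.1, h.2, not_le.1 h1]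
  have hts : tsupport χ ⊆ Set.Icc p q := closure_minimal hsupp isClosed_Icc
  refine ⟨χ, ?_, HasCompactSupport.of_support_subset_isCompact isCompact_Icc hsupp,
    hts.trans (hU.out (hs hp) (hs hq)), hderiv⟩
  rw [contDiff_infty_iff_deriv, hderiv]
  exact ⟨fun s => (hd s).differentiableAt, hg⟩

lemma exists_test_integral_one {U : Set ℝ} (hU : IsOpen U) (hne : U.Nonempty) :
    ∃ θ : ℝ → ℝ, ContDiff ℝ ∞ θ ∧ HasCompactSupport θ ∧ tsupport θ ⊆ U ∧ ∫ x, θ x = 1 := by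
  obtain ⟨x₀, hx₀⟩ := hne
  obtain ⟨δ, hδ, hb⟩ := Metric.isOpen_iff.1 hU x₀ hx₀
  let B : ContDiffBump x₀ := ⟨δ / 4, δ / 2, by positivity, by linarith⟩
  refine ⟨B.normed volume, B.contDiff_normed, B.hasCompactSupport_normed, ?_, B.integral_normed⟩
  rw [B.tsupport_normed_eq]
  exact (Metric.closedBall_subset_ball (by change δ / 2 < δ; linarith)).trans hb

lemma integrable_smul_of_test {f : ℝ → ℂ} (hf : LocallyIntegrable f) {g : ℝ → ℝ}
    (hg : ContDiff ℝ ∞ g) (hc : HasCompactSupport g) : Integrable (fun x => g x • f x) :=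
  hf.integrable_smul_left_of_hasCompactSupport hg.continuous hc

/-- Subtracting a multiple of a fixed function of unit mass makes a test function a derivative. -/
lemma exists_primitive_sub {U : Set ℝ} (hU : U.OrdConnected) {θ g : ℝ → ℝ}
    (hθ : ContDiff ℝ ∞ θ) (hθc : HasCompactSupport θ) (hθs : tsupport θ ⊆ U)
    (hθ1 : ∫ x, θ x = 1) (hg : ContDiff ℝ ∞ g) (hc : HasCompactSupport g) (hs : tsupport g ⊆ U) :
    ∃ χ : ℝ → ℝ, ContDiff ℝ ∞ χ ∧ HasCompactSupport χ ∧ tsupport χ ⊆ U ∧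
      deriv χ = fun x => g x - (∫ y, g y) * θ x := by
  refine exists_primitive hU (hg.sub (contDiff_const.mul hθ)) (hc.sub hθc.mul_left) ?_ ?_
  · refine (tsupport_sub g _).trans (Set.union_subset hs ?_)
    exact (tsupport_mul_subset_right (f := fun _ => ∫ y, g y)).trans hθs
  · rw [integral_sub (hg.continuous.integrable_of_hasCompactSupport hc)
      ((hθ.continuous.integrable_of_hasCompactSupport hθc).const_mul _), integral_const_mul, hθ1]
    ring

/-- The du Bois-Reymond argument: `g - (∫ g) θ` is the derivative of a test function, so `f` acts on
`g` as the constant `∫ θ f`. -/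
lemma ae_const_of_weak_deriv {U : Set ℝ} (hU : U.OrdConnected) (hUo : IsOpen U)
    (hne : U.Nonempty) {f : ℝ → ℂ} (hf : LocallyIntegrable f)
    (h : ∀ χ : ℝ → ℝ, ContDiff ℝ ∞ χ → HasCompactSupport χ → tsupport χ ⊆ U →
      ∫ x, deriv χ x • f x = 0) :
    ∃ c : ℂ, ∀ᵐ x, x ∈ U → f x = c := by
  obtain ⟨θ, hθ, hθc, hθs, hθ1⟩ := exists_test_integral_one hUo hne
  refine ⟨∫ x, θ x • f x, ?_⟩
  have key := hUo.ae_eq_zero_of_integral_contDiff_smul_eq_zero (μ := volume)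
    (f := fun x => f x - ∫ y, θ y • f y)
    ((hf.sub (locallyIntegrable_const _)).locallyIntegrableOn U) ?_
  · filter_upwards [key] with x hx hxU
    exact sub_eq_zero.1 (hx hxU)
  · intro g hg hc hs
    obtain ⟨χ, h1, h2, h3, h4⟩ := exists_primitive_sub hU hθ hθc hθs hθ1 hg hc hs
    have e := h χ h1 h2 h3
    simp_rw [h4, sub_smul, mul_smul] at e
    rw [integral_sub (integrable_smul_of_test hf hg hc)
      (by exact (integrable_smul_of_test hf hθ hθc).smul _), integral_smul] at e
    simp_rw [smul_sub]
    rw [integral_sub (integrable_smul_of_test hf hg hc)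
      (integrable_smul_of_test (locallyIntegrable_const _) hg hc), integral_smul_const]
    exact e

lemma ae_affine_of_weak_deriv_deriv {U : Set ℝ} (hU : U.OrdConnected) (hUo : IsOpen U)
    (hne : U.Nonempty) {f : ℝ → ℂ} (hf : LocallyIntegrable f)
    (h : ∀ χ : ℝ → ℝ, ContDiff ℝ ∞ χ → HasCompactSupport χ → tsupport χ ⊆ U →
      ∫ x, deriv (deriv χ) x • f x = 0) :
    ∃ a b : ℂ, ∀ᵐ x : ℝ, x ∈ U → f x = b + a * x := by
  obtain ⟨θ, hθ, hθc, hθs, hθ1⟩ := exists_test_integral_one hUo hne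
  -- Using `χ' = g - (∫ g) θ` in the hypothesis gives `∫ g' f = c ∫ g`, that is `f' = -c` weakly;
  -- hence `f + c x` is weakly constant.
  set c : ℂ := ∫ x, deriv θ x • f x
  have hlin : LocallyIntegrable (fun x : ℝ => c * (x : ℂ)) :=
    Continuous.locallyIntegrable (by fun_prop)
  obtain ⟨b, hb⟩ := ae_const_of_weak_deriv hU hUo hne (hf.add hlin) (fun g hg hc hs => by
    obtain ⟨χ, h1, h2, h3, h4⟩ := exists_primitive_sub hU hθ hθc hθs hθ1 hg hc hs
    have hg' : ContDiff ℝ ∞ (deriv g) := (contDiff_infty_iff_deriv.1 hg).2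
    have hθ' : ContDiff ℝ ∞ (deriv θ) := (contDiff_infty_iff_deriv.1 hθ).2
    have hgd : Differentiable ℝ g := (contDiff_infty_iff_deriv.1 hg).1
    have hθd : Differentiable ℝ θ := (contDiff_infty_iff_deriv.1 hθ).1
    have e := h χ h1 h2 h3
    have e1 : ∀ x, deriv (deriv χ) x = deriv g x - (∫ y, g y) * deriv θ x := by
      intro x
      rw [h4]
      exact ((hgd x).hasDerivAt.sub ((hθd x).hasDerivAt.const_mul _)).deriv
    simp_rw [e1, sub_smul, mul_smul] at e
    rw [integral_sub (integrable_smul_of_test hf hg' hc.deriv)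
      (by exact (integrable_smul_of_test hf hθ' hθc.deriv).smul _), integral_smul] at e
    have e2 : ∫ x, x * deriv g x = -∫ x, g x := by
      have := integral_mul_deriv_eq_deriv_mul_of_integrable (u := fun x : ℝ => x) (v := g)
        (u' := fun _ => 1) (v' := deriv g) (fun x _ => hasDerivAt_id x)
        (fun x _ => (hgd x).hasDerivAt)
        ((continuous_id.mul hg'.continuous).integrable_of_hasCompactSupport hc.deriv.mul_left)
        ((continuous_const.mul hg.continuous).integrable_of_hasCompactSupport hc.mul_left)
        ((continuous_id.mul hg.continuous).integrable_of_hasCompactSupport hc.mul_left)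
      simpa using this
    have e3 : ∫ x, deriv g x • (c * (x : ℂ)) = -((∫ x, g x) • c) := by
      have : ∀ x : ℝ, deriv g x • (c * (x : ℂ)) = c * ((x * deriv g x : ℝ) : ℂ) := by
        intro x; rw [Complex.real_smul]; push_cast; ring
      simp_rw [this]
      rw [integral_const_mul, integral_complex_ofReal, e2, Complex.real_smul]
      push_cast
      ring
    simp only [Pi.add_apply, smul_add]
    rw [integral_add (integrable_smul_of_test hf hg' hc.deriv)
      (integrable_smul_of_test hlin hg' hc.deriv), e3]
    rw [← sub_eq_add_neg]
    exact e)
  refine ⟨-c, b, ?_⟩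
  filter_upwards [hb] with x hx hxU
  have := hx hxU
  simp only [Pi.add_apply] at this
  linear_combination this

/-! ### Piecewise affine functions -/

lemma integrable_affine_test {g : ℝ → ℝ} (hg : ContDiff ℝ ∞ g) (hc : HasCompactSupport g)
    (α β : ℂ) :
    Integrable (fun s : ℝ => β * (g s : ℂ) + (α + β * s) * ((deriv g s : ℝ) : ℂ)) := by
  have hg' : ContDiff ℝ ∞ (deriv g) := (contDiff_infty_iff_deriv.1 hg).2
  have h1 : Integrable (fun s : ℝ => (g s : ℂ)) :=
    (hg.continuous.integrable_of_hasCompactSupport hc).ofReal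
  have h2 : Integrable (fun s : ℝ => (α + β * s) * ((deriv g s : ℝ) : ℂ)) := by
    have := integrable_smul_of_test (f := fun s : ℝ => α + β * s)
      (Continuous.locallyIntegrable (by fun_prop)) hg' hc.deriv
    refine this.congr (Filter.Eventually.of_forall fun s => ?_)
    simp only [Complex.real_smul]
    ring
  exact (h1.const_mul β).add h2

lemma hasDerivAt_affine_mul {g : ℝ → ℝ} (hg : ContDiff ℝ ∞ g) (α β : ℂ) (s : ℝ) :
    HasDerivAt (fun s : ℝ => (α + β * s) * (g s : ℂ))
      (β * (g s : ℂ) + (α + β * s) * ((deriv g s : ℝ) : ℂ)) s := by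
  have h1 : HasDerivAt (fun s : ℝ => α + β * (s : ℂ)) β s := by
    simpa using ((hasDerivAt_id s).ofReal_comp.const_mul β).const_add α
  have h2 := (((contDiff_infty_iff_deriv.1 hg).1 s).hasDerivAt).ofReal_comp
  exact h1.mul h2

lemma contDiff_affine_mul {g : ℝ → ℝ} (hg : ContDiff ℝ ∞ g) (α β : ℂ) :
    ContDiff ℝ 1 (fun s : ℝ => (α + β * s) * (g s : ℂ)) := by
  have h1 : ContDiff ℝ 1 (fun s : ℝ => (s : ℂ)) := Complex.ofRealCLM.contDiff
  have h2 : ContDiff ℝ 1 (fun s : ℝ => (g s : ℂ)) :=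
    Complex.ofRealCLM.contDiff.comp (hg.of_le (by simp))
  exact (contDiff_const.add (contDiff_const.mul h1)).mul h2

/-- The jump of a piecewise affine function against a test function. -/
lemma integral_piecewise_affine {g : ℝ → ℝ} (hg : ContDiff ℝ ∞ g) (hc : HasCompactSupport g)
    (σ : ℝ) (α β α' β' : ℂ) {P : ℝ → ℂ}
    (h1 : ∀ᵐ s : ℝ, s < σ → P s = β * (g s : ℂ) + (α + β * s) * ((deriv g s : ℝ) : ℂ))
    (h2 : ∀ᵐ s : ℝ, σ < s → P s = β' * (g s : ℂ) + (α' + β' * s) * ((deriv g s : ℝ) : ℂ)) :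
    ∫ s, P s = ((α + β * σ) - (α' + β' * σ)) * (g σ : ℂ) := by
  have hne : ∀ᵐ s : ℝ, s ≠ σ := by simp [ae_iff]
  have hcc : ∀ α β : ℂ, HasCompactSupport (fun s : ℝ => (α + β * s) * (g s : ℂ)) :=
    fun α β => (hc.comp_left (g := ((↑) : ℝ → ℂ)) (by simp)).mul_left
  have e1 : ∀ᵐ s ∂(volume.restrict (Set.Iic σ)),
      P s = β * (g s : ℂ) + (α + β * s) * ((deriv g s : ℝ) : ℂ) := by
    rw [ae_restrict_iff' measurableSet_Iic]
    filter_upwards [h1, hne] with s hs hn hle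
    exact hs (lt_of_le_of_ne hle hn)
  have e2 : ∀ᵐ s ∂(volume.restrict (Set.Ioi σ)),
      P s = β' * (g s : ℂ) + (α' + β' * s) * ((deriv g s : ℝ) : ℂ) := by
    rw [ae_restrict_iff' measurableSet_Ioi]
    exact h2
  have hi1 : IntegrableOn P (Set.Iic σ) :=
    ((integrable_affine_test hg hc α β).integrableOn).congr
      (by filter_upwards [e1] with s hs; exact hs.symm)
  have hi2 : IntegrableOn P (Set.Ioi σ) :=
    ((integrable_affine_test hg hc α' β').integrableOn).congr
      (by filter_upwards [e2] with s hs; exact hs.symm)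
  rw [← intervalIntegral.integral_Iic_add_Ioi hi1 hi2, integral_congr_ae e1, integral_congr_ae e2]
  -- On each side `P` is the derivative of an affine function times `g`, so only the values at `σ`
  -- remain.
  have k1 := (hcc α β).integral_Iic_deriv_eq (contDiff_affine_mul hg α β) σ
  have k2 := (hcc α' β').integral_Ioi_deriv_eq (contDiff_affine_mul hg α' β') σ
  simp_rw [(hasDerivAt_affine_mul hg α β _).deriv] at k1
  simp_rw [(hasDerivAt_affine_mul hg α' β' _).deriv] at k2
  rw [k1, k2]
  ring

noncomputable section

/-! ### Radial integrals -/

section Radial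

variable {F : Type*} [NormedAddCommGroup F] [NormedSpace ℝ F]

/-- In the plane `s = |x|²` has `ds = 2|x| d|x|`, so the density in `s` is constant and equals the
area of the unit disc. -/
lemma integral_norm_sq (f : ℝ → F) :
    ∫ x : Plane, f (‖x‖ ^ 2)
      = (volume.real (Metric.ball (0 : Plane) 1)) • ∫ s in Set.Ioi (0 : ℝ), f s := by
  have h1 := integral_fun_norm_addHaar (volume : Measure Plane) (fun y => f (y ^ 2))
  have h2 := integral_comp_rpow_Ioi_of_pos (g := f) (p := 2) (by norm_num)
  have h3 : ∀ x : ℝ, ((2 : ℝ) * x ^ ((2 : ℝ) - 1)) • f (x ^ (2 : ℝ)) = (2 : ℝ) • (x • f (x ^ 2)) := by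
    intro x
    norm_num [mul_smul]
  simp_rw [h3] at h2
  rw [integral_smul] at h2
  rw [h1, ← h2, smul_comm]
  simp [two_smul]

lemma integrable_norm_sq_iff {f : ℝ → F} :
    Integrable (fun x : Plane => f (‖x‖ ^ 2)) ↔ IntegrableOn f (Set.Ioi 0) := by
  have h1 := integrable_fun_norm_addHaar (volume : Measure Plane) (f := fun y => f (y ^ 2))
  have h2 := integrableOn_Ioi_comp_rpow_iff f (p := 2) (by norm_num)
  rw [h1, ← h2]
  have : (fun x : ℝ => (|(2 : ℝ)| * x ^ ((2 : ℝ) - 1)) • f (x ^ (2 : ℝ)))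
      = (2 : ℝ) • fun x : ℝ => (x ^ (Module.finrank ℝ Plane - 1)) • f (x ^ 2) := by
    ext x
    norm_num [mul_smul]
  rw [this, IntegrableOn, IntegrableOn, integrable_smul_iff (by norm_num)]

end Radial

lemma volume_ball_pos : 0 < volume.real (Metric.ball (0 : Plane) 1) :=
  ENNReal.toReal_pos (Metric.measure_ball_pos _ _ one_pos).ne' measure_ball_lt_top.ne

/-- The indicator of the exceptional set is almost everywhere zero on the half-line, hence
integrable, and the change of variables gives its pullback integral zero. -/
lemma ae_norm_sq {p : ℝ → Prop} (h : ∀ᵐ s : ℝ, 0 < s → p s) : ∀ᵐ x : Plane, p (‖x‖ ^ 2) := by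
  classical
  have h0 : ∀ᵐ s ∂(volume.restrict (Set.Ioi (0 : ℝ))), (if p s then (0 : ℝ) else 1) = 0 := by
    rw [ae_restrict_iff' measurableSet_Ioi]
    filter_upwards [h] with s hs hs0
    simp [hs hs0]
  have hi : IntegrableOn (fun s : ℝ => if p s then (0 : ℝ) else 1) (Set.Ioi 0) :=
    (integrable_zero _ _ _).congr (by filter_upwards [h0] with s hs; exact hs.symm)
  have h1 := integral_norm_sq (fun s => if p s then (0 : ℝ) else 1)
  rw [integral_congr_ae h0] at h1
  simp only [integral_zero, smul_zero] at h1
  rw [integral_eq_zero_iff_of_nonneg (fun x => by dsimp only; split_ifs <;> simp)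
    (integrable_norm_sq_iff.2 hi)] at h1
  filter_upwards [h1] with x hx
  by_contra hp
  simp [hp] at hx

/-! ### Radial test functions -/

lemma hasCompactSupport_norm_sq {ψ : ℝ → ℝ} (hc : HasCompactSupport ψ) :
    HasCompactSupport (fun x : Plane => ψ (‖x‖ ^ 2)) := by
  obtain ⟨R, hR⟩ := hc.isCompact.isBounded.subset_closedBall 0
  refine HasCompactSupport.intro (isCompact_closedBall (0 : Plane) (|R| + 1)) fun x hx => ?_
  refine image_eq_zero_of_notMem_tsupport fun h => ?_
  have h1 := hR h
  simp only [Metric.mem_closedBall, dist_zero_right, not_le, Real.norm_eq_abs] at h1 hx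
  rw [abs_of_nonneg (by positivity)] at h1
  nlinarith [abs_nonneg R, le_abs_self R]

lemma isTest_norm_sq {ψ : ℝ → ℝ} (hψ : ContDiff ℝ ∞ ψ) (hc : HasCompactSupport ψ) :
    IsTest (fun x => ψ (‖x‖ ^ 2)) :=
  ⟨hψ.comp (contDiff_norm_sq ℝ), hasCompactSupport_norm_sq hc⟩

lemma isTest_norm_sq_mul {ψ : ℝ → ℝ} (hψ : ContDiff ℝ ∞ ψ) (hc : HasCompactSupport ψ)
    (i : Fin 2) : IsTest (fun x => x i * ψ (‖x‖ ^ 2)) :=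
  IsTest.mul (by fun_prop) (isTest_norm_sq hψ hc)

lemma hasFDerivAt_norm_sq {ψ : ℝ → ℝ} (hψ : ContDiff ℝ ∞ ψ) (x : Plane) :
    HasFDerivAt (fun x : Plane => ψ (‖x‖ ^ 2))
      (deriv ψ (‖x‖ ^ 2) • (2 • innerSL ℝ x)) x :=
  ((contDiff_infty_iff_deriv.1 hψ).1 _).hasDerivAt.comp_hasFDerivAt x
    (hasStrictFDerivAt_norm_sq x).hasFDerivAt

lemma partialDeriv_norm_sq {ψ : ℝ → ℝ} (hψ : ContDiff ℝ ∞ ψ) (j : Fin 2) (x : Plane) :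
    partialDeriv (fun x => ψ (‖x‖ ^ 2)) j x = 2 * x j * deriv ψ (‖x‖ ^ 2) := by
  rw [partialDeriv, (hasFDerivAt_norm_sq hψ x).fderiv]
  simp [EuclideanSpace.inner_single_right]
  ring

lemma partialDeriv_norm_sq_mul {ψ : ℝ → ℝ} (hψ : ContDiff ℝ ∞ ψ) (i j : Fin 2) (x : Plane) :
    partialDeriv (fun x => x i * ψ (‖x‖ ^ 2)) j x
      = (if i = j then ψ (‖x‖ ^ 2) else 0) + 2 * x i * x j * deriv ψ (‖x‖ ^ 2) := by
  have h1 : HasFDerivAt (fun x : Plane => x i) (EuclideanSpace.proj (𝕜 := ℝ) i) x :=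
    (EuclideanSpace.proj (𝕜 := ℝ) i : Plane →L[ℝ] ℝ).hasFDerivAt
  have h2 : HasFDerivAt (fun x : Plane => x i * ψ (‖x‖ ^ 2)) _ x :=
    h1.mul (hasFDerivAt_norm_sq hψ x)
  rw [partialDeriv, h2.fderiv]
  simp [EuclideanSpace.inner_single_right]
  split_ifs <;> ring

/-! ### The profile of a radial field -/

/-- The function `s ↦ s f(√s)` on `s > 0`, so that `u · x = profile f (|x|²)` for `u = f(|x|) x`. -/
def profile (f : ℝ → ℂ) (s : ℝ) : ℂ := if 0 < s then f (√s) * s else 0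

lemma profile_norm_sq (f : ℝ → ℂ) (x : Plane) :
    profile f (‖x‖ ^ 2) = f ‖x‖ * (‖x‖ : ℂ) ^ 2 := by
  rcases eq_or_ne x 0 with rfl | h
  · simp [profile]
  · have : 0 < ‖x‖ ^ 2 := by positivity
    simp [profile, this]

lemma setIntegral_Ioi_profile_mul (f : ℝ → ℂ) (g : ℝ → ℂ) :
    ∫ s in Set.Ioi 0, profile f s * g s = ∫ s, profile f s * g s := by
  refine setIntegral_eq_integral_of_forall_compl_eq_zero fun s hs => ?_
  simp [profile, show ¬ 0 < s from hs]

lemma sum_smul_position (c : ℂ) (x : Plane) :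
    ∑ i, (c • position x) i * (x i : ℂ) = c * (‖x‖ : ℂ) ^ 2 := by
  have : (‖x‖ : ℂ) ^ 2 = (x 0 : ℂ) ^ 2 + (x 1 : ℂ) ^ 2 := by exact_mod_cast norm_sq_eq x
  simp [Fin.sum_univ_two, position, this]
  ring

/-- The function `f` is arbitrary; its regularity is read off from `v · x = profile f (|x|²)`, which
is locally integrable on the plane. -/
lemma locallyIntegrable_profile {v : Plane → CVec} (hv : ∀ i, IsL2Loc (fun x => v x i)) {f : ℝ → ℂ}
    (hf : ∀ᵐ x : Plane, v x = f ‖x‖ • position x) : LocallyIntegrable (profile f) := by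
  rw [locallyIntegrable_iff]
  intro K hK
  obtain ⟨R, hR⟩ := hK.isBounded.subset_closedBall 0
  have h1 : Integrable (fun x : Plane =>
      (Set.Iic R).indicator (profile f) (‖x‖ ^ 2)) := by
    have hK : IsCompact (Metric.closedBall (0 : Plane) (|R| + 1)) := isCompact_closedBall _ _
    have e : IntegrableOn (fun x : Plane => ∑ i, v x i * (x i : ℂ))
        (Metric.closedBall (0 : Plane) (|R| + 1)) := by
      refine integrable_finsetSum _ fun i _ => ?_
      have := ((hv i).locallyIntegrable.integrableOn_isCompact hK).continuousOn_mul
        (g := fun x : Plane => (x i : ℂ)) (Continuous.continuousOn (by fun_prop)) hK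
      simpa [mul_comm, IntegrableOn] using this
    have hm : MeasurableSet {x : Plane | ‖x‖ ^ 2 ≤ R} :=
      (isClosed_le (by fun_prop) continuous_const).measurableSet
    have hsub : {x : Plane | ‖x‖ ^ 2 ≤ R} ⊆ Metric.closedBall (0 : Plane) (|R| + 1) := by
      intro x hx
      simp only [Metric.mem_closedBall, dist_zero_right]
      have : ‖x‖ ^ 2 ≤ R := hx
      nlinarith [abs_nonneg R, le_abs_self R, norm_nonneg x]
    refine ((integrable_indicator_iff hm).2 (e.mono_set hsub)).congr ?_
    filter_upwards [hf] with x hx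
    by_cases hxR : ‖x‖ ^ 2 ≤ R
    · rw [Set.indicator_of_mem (show x ∈ {x : Plane | ‖x‖ ^ 2 ≤ R} from hxR),
        Set.indicator_of_mem (show ‖x‖ ^ 2 ∈ Set.Iic R from hxR), hx, sum_smul_position,
        profile_norm_sq]
    · rw [Set.indicator_of_notMem (show x ∉ {x : Plane | ‖x‖ ^ 2 ≤ R} from hxR),
        Set.indicator_of_notMem (show ‖x‖ ^ 2 ∉ Set.Iic R from hxR)]
  have h2 := integrable_norm_sq_iff.1 h1
  have h3 : Integrable ((Set.Iic R).indicator (profile f)) := by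
    refine (integrableOn_iff_integrable_of_support_subset fun s hs => ?_).1 h2
    by_contra h
    refine hs ?_
    have : profile f s = 0 := by simp [profile, show ¬ 0 < s from h]
    by_cases hsR : s ∈ Set.Iic R <;> simp [Set.indicator, this]
  refine ((integrable_indicator_iff measurableSet_Iic).1 h3).mono_set fun s hs => ?_
  have := hR hs
  simp only [Metric.mem_closedBall, dist_zero_right, Real.norm_eq_abs] at this
  exact (le_abs_self s).trans this

/-- The divergence of a radial field, tested with radial functions. -/
lemma HasH1LocGrad.integral_trace {v : Plane → CVec} {G : Plane → Fin 2 → Fin 2 → ℂ}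
    (hv : HasH1LocGrad v G) {f : ℝ → ℂ} (hf : ∀ᵐ x : Plane, v x = f ‖x‖ • position x)
    {ψ : ℝ → ℝ} (hψ : ContDiff ℝ ∞ ψ) (hc : HasCompactSupport ψ) :
    ∫ x, (G x 0 0 + G x 1 1) * (ψ (‖x‖ ^ 2) : ℂ)
      = -(2 * (volume.real (Metric.ball (0 : Plane) 1) : ℂ)
        * ∫ s, profile f s * ((deriv ψ s : ℝ) : ℂ)) := by
  have ht := isTest_norm_sq hψ hc
  have hi : ∀ i, Integrable (fun x => v x i * (partialDeriv (fun x => ψ (‖x‖ ^ 2)) i x : ℂ)) :=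
    fun i => (hv.l2 i).integrable_mul (ht.partialDeriv i)
  have e1 : ∫ x, (G x 0 0 + G x 1 1) * (ψ (‖x‖ ^ 2) : ℂ)
      = -∫ x, (v x 0 * (partialDeriv (fun x => ψ (‖x‖ ^ 2)) 0 x : ℂ)
        + v x 1 * (partialDeriv (fun x => ψ (‖x‖ ^ 2)) 1 x : ℂ)) := by
    simp_rw [add_mul]
    rw [integral_add (hi 0) (hi 1), hv.weak 0 0 _ ht, hv.weak 1 1 _ ht,
      integral_add ((hv.l2_grad 0 0).integrable_mul ht) ((hv.l2_grad 1 1).integrable_mul ht)]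
    ring
  have e2 : ∫ x, (v x 0 * (partialDeriv (fun x => ψ (‖x‖ ^ 2)) 0 x : ℂ)
        + v x 1 * (partialDeriv (fun x => ψ (‖x‖ ^ 2)) 1 x : ℂ))
      = ∫ x : Plane, 2 * (profile f (‖x‖ ^ 2) * ((deriv ψ (‖x‖ ^ 2) : ℝ) : ℂ)) := by
    refine integral_congr_ae ?_
    filter_upwards [hf] with x hx
    have h := sum_smul_position (f ‖x‖) x
    rw [Fin.sum_univ_two, ← hx] at h
    rw [partialDeriv_norm_sq hψ, partialDeriv_norm_sq hψ, profile_norm_sq, ← h]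
    push_cast
    ring
  rw [e1, e2, integral_const_mul,
    integral_norm_sq (fun s => profile f s * ((deriv ψ s : ℝ) : ℂ)), setIntegral_Ioi_profile_mul,
    Complex.real_smul]
  ring

/-! ### Radial test fields inside a layer -/

/-- Inside a layer with nonzero coefficient, the divergence of a weak solution is weakly constant
in the radial direction. -/
lemma IsWeakLame.integral_trace_eq_zero {N : ℕ} {r : ℕ → ℝ}
    (hr : ∀ j, 1 ≤ j → j < N → r (j + 1) < r j) {lam mu : ℝ} (hlm : 0 < lam + 2 * mu) {ε : ℕ → ℂ}
    {v : Plane → CVec} {G : Plane → Fin 2 → Fin 2 → ℂ} (hv : HasH1LocGrad v G)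
    (hG : IsWeakLame (epsField N r ε) lam mu G) {j : ℕ} (hj : j ≤ N) (hε : ε j ≠ 0)
    {ψ : ℝ → ℝ} (hψ : ContDiff ℝ ∞ ψ) (hc : HasCompactSupport ψ)
    (hs : ∀ x : Plane, ‖x‖ ^ 2 ∈ tsupport ψ → x ∈ layer N r j) :
    ∫ x, (G x 0 0 + G x 1 1) * ((ψ (‖x‖ ^ 2) + ‖x‖ ^ 2 * deriv ψ (‖x‖ ^ 2) : ℝ) : ℂ) = 0 := by
  set φ : Fin 2 → Plane → ℝ := fun i x => x i * ψ (‖x‖ ^ 2)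
  have hφ : ∀ i, IsTest (φ i) := isTest_norm_sq_mul hψ hc
  have hD : ∀ i l x, partialDeriv (φ i) l x
      = (if i = l then ψ (‖x‖ ^ 2) else 0) + 2 * x i * x l * deriv ψ (‖x‖ ^ 2) :=
    fun i l x => partialDeriv_norm_sq_mul hψ i l x
  have h1 := hG φ hφ
  have h2 := hv.integral_cofactor hφ
  have hi : ∀ i l k m, Integrable (fun x => G x i l * (partialDeriv (φ k) m x : ℂ)) :=
    fun i l k m => (hv.l2_grad i l).integrable_mul ((hφ k).partialDeriv m)
  have hi3 : Integrable (fun x => (G x 0 0 + G x 1 1)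
      * ((ψ (‖x‖ ^ 2) + ‖x‖ ^ 2 * deriv ψ (‖x‖ ^ 2) : ℝ) : ℂ)) := by
    refine ((((hi 0 0 0 0).add (hi 0 0 1 1)).add
      ((hi 1 1 0 0).add (hi 1 1 1 1))).const_mul (1 / 2)).congr
      (Filter.Eventually.of_forall fun x => ?_)
    simp only [Pi.add_apply, hD, norm_sq_eq]
    simp
    ring
  have hi2 : Integrable (fun x => ∑ i, ∑ l, ((G x 0 0 + G x 1 1) * kron i l - G x l i)
      * (partialDeriv (φ i) l x : ℂ)) := by
    refine integrable_finsetSum _ fun i _ => integrable_finsetSum _ fun l _ => ?_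
    refine ((((hi 0 0 i l).add (hi 1 1 i l)).const_mul (kron i l)).sub (hi l i i l)).congr
      (Filter.Eventually.of_forall fun x => ?_)
    simp only [Pi.sub_apply, Pi.add_apply]
    ring
  -- As `∇φ` is symmetric, the work is `ε_j (λ tr G div φ + 2μ Gᵀ : ∇φ)`. Trading `Gᵀ` for the
  -- cofactor matrix `tr G I - Gᵀ` leaves `ε_j (λ + 2μ) tr G div φ`, with `div φ = 2(ψ + sψ')`.
  have e : ∀ x, ∑ i, ∑ l, (∑ k, ∑ m, elasticTensor (epsField N r ε x * lam)
        (epsField N r ε x * mu) i l k m * symPart (G x) k m) * (partialDeriv (φ i) l x : ℂ)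
      = (2 * ε j * (lam + 2 * mu)) * ((G x 0 0 + G x 1 1)
          * ((ψ (‖x‖ ^ 2) + ‖x‖ ^ 2 * deriv ψ (‖x‖ ^ 2) : ℝ) : ℂ))
        - (2 * mu * ε j) * ∑ i, ∑ l, ((G x 0 0 + G x 1 1) * kron i l - G x l i)
          * (partialDeriv (φ i) l x : ℂ) := by
    intro x
    by_cases hx : ‖x‖ ^ 2 ∈ tsupport ψ
    · rw [epsField_eq hr ε hj (hs x hx)]
      simp only [sum_elasticTensor, hD, norm_sq_eq]
      simp [Fin.sum_univ_two, kron]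
      ring
    · have z1 : ψ (‖x‖ ^ 2) = 0 := image_eq_zero_of_notMem_tsupport hx
      have z2 : deriv ψ (‖x‖ ^ 2) = 0 := by
        by_contra h
        exact hx (support_deriv_subset h)
      simp [hD, z1, z2]
  simp_rw [e] at h1
  rw [integral_sub (hi3.const_mul _) (hi2.const_mul _), integral_const_mul, integral_const_mul,
    h2, mul_zero, sub_zero] at h1
  refine (mul_eq_zero.1 h1).resolve_left ?_
  have : ((lam + 2 * mu : ℝ) : ℂ) ≠ 0 := by exact_mod_cast hlm.ne'
  push_cast at this
  exact mul_ne_zero (mul_ne_zero two_ne_zero hε) this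

/-- The squared radii of the interior of layer `j`, without the origin. -/
def shell (N : ℕ) (r : ℕ → ℝ) (j : ℕ) : Set ℝ :=
  {s | 0 < s ∧ (1 ≤ j → s < r j ^ 2) ∧ (j < N → r (j + 1) ^ 2 < s)}

lemma isOpen_shell (N : ℕ) (r : ℕ → ℝ) (j : ℕ) : IsOpen (shell N r j) := by
  have h1 : IsOpen {s : ℝ | 1 ≤ j → s < r j ^ 2} := by
    by_cases h : 1 ≤ j
    · simpa [h] using! isOpen_Iio
    · simp [h]
  have h2 : IsOpen {s : ℝ | j < N → r (j + 1) ^ 2 < s} := by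
    by_cases h : j < N
    · simpa [h] using! isOpen_Ioi
    · simp [h]
  exact (isOpen_Ioi (a := (0 : ℝ))).inter (h1.inter h2)

lemma ordConnected_shell (N : ℕ) (r : ℕ → ℝ) (j : ℕ) : (shell N r j).OrdConnected :=
  ⟨fun _ hx _ hy _ hz => ⟨hx.1.trans_le hz.1, fun h => hz.2.trans_lt (hy.2.1 h),
    fun h => (hx.2.2 h).trans_le hz.1⟩⟩

lemma mem_layer_of_mem_shell {N : ℕ} {r : ℕ → ℝ} (hr0 : ∀ j, 1 ≤ j → j ≤ N → 0 < r j) {j : ℕ}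
    (hj : j ≤ N) {x : Plane} (hx : ‖x‖ ^ 2 ∈ shell N r j) : x ∈ layer N r j :=
  ⟨fun h => (lt_of_pow_lt_pow_left₀ 2 (hr0 j h hj).le (hx.2.1 h)).le,
    fun h => lt_of_pow_lt_pow_left₀ 2 (norm_nonneg x) (hx.2.2 h)⟩

lemma mem_shell_of_mem_layer {N : ℕ} {r : ℕ → ℝ} (hr0 : ∀ j, 1 ≤ j → j ≤ N → 0 < r j) {j : ℕ}
    {x : Plane} (h0 : 0 < ‖x‖) (hx : ∀ k, ‖x‖ ≠ r k) (hxj : x ∈ layer N r j) :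
    ‖x‖ ^ 2 ∈ shell N r j :=
  ⟨by positivity,
    fun h => pow_lt_pow_left₀ (lt_of_le_of_ne (hxj.1 h) (hx j)) h0.le two_ne_zero,
    fun h => pow_lt_pow_left₀ (hxj.2 h) (hr0 (j + 1) (by omega) h).le two_ne_zero⟩

/-- Neighbouring layers near their interface. -/
lemma exists_interface_nhds {N : ℕ} {r : ℕ → ℝ} (hr0 : ∀ j, 1 ≤ j → j ≤ N → 0 < r j)
    (hr : ∀ j, 1 ≤ j → j < N → r (j + 1) < r j) {k : ℕ} (hk : k < N) :
    ∃ δ > 0, δ ≤ r (k + 1) ^ 2 ∧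
      (∀ s, r (k + 1) ^ 2 - δ < s → s < r (k + 1) ^ 2 → s ∈ shell N r (k + 1)) ∧
      (∀ s, r (k + 1) ^ 2 < s → s < r (k + 1) ^ 2 + δ → s ∈ shell N r k) := by
  have h0 := hr0 (k + 1) (by omega) hk
  obtain ⟨L, hL0, hL, hL'⟩ : ∃ L, 0 ≤ L ∧ L < r (k + 1) ^ 2 ∧
      (k + 1 < N → r (k + 1 + 1) ^ 2 ≤ L) := by
    by_cases h : k + 1 < N
    · have h1 := hr0 (k + 1 + 1) (by omega) h
      exact ⟨r (k + 1 + 1) ^ 2, by positivity,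
        pow_lt_pow_left₀ (hr (k + 1) (by omega) h) h1.le two_ne_zero, fun _ => le_rfl⟩
    · exact ⟨0, le_rfl, by positivity, fun h' => absurd h' h⟩
  obtain ⟨M, hM, hM'⟩ : ∃ M, r (k + 1) ^ 2 < M ∧ (1 ≤ k → M ≤ r k ^ 2) := by
    by_cases h : 1 ≤ k
    · exact ⟨r k ^ 2, pow_lt_pow_left₀ (hr k h hk) h0.le two_ne_zero, fun _ => le_rfl⟩
    · exact ⟨r (k + 1) ^ 2 + 1, by linarith, fun h' => absurd h' h⟩
  refine ⟨min (r (k + 1) ^ 2 - L) (M - r (k + 1) ^ 2), lt_min (by linarith) (by linarith), ?_,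
    fun s h1 h2 => ?_, fun s h1 h2 => ?_⟩
  · exact (min_le_left _ _).trans (by linarith)
  · have := min_le_left (r (k + 1) ^ 2 - L) (M - r (k + 1) ^ 2)
    exact ⟨by linarith, fun _ => h2, fun h => by linarith [hL' h]⟩
  · have := min_le_right (r (k + 1) ^ 2 - L) (M - r (k + 1) ^ 2)
    exact ⟨by nlinarith, fun h => by linarith [hM' h], fun _ => h1⟩

lemma shell_nonempty {N : ℕ} (hN : 1 ≤ N) {r : ℕ → ℝ} (hr0 : ∀ j, 1 ≤ j → j ≤ N → 0 < r j)
    (hr : ∀ j, 1 ≤ j → j < N → r (j + 1) < r j) {j : ℕ} (hj : j ≤ N) : (shell N r j).Nonempty := by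
  rcases hj.lt_or_eq with h | rfl
  · obtain ⟨δ, h1, -, -, h2⟩ := exists_interface_nhds hr0 hr h
    exact ⟨_, h2 (r (j + 1) ^ 2 + δ / 2) (by linarith) (by linarith)⟩
  · have := hr0 j hN le_rfl
    exact ⟨r j ^ 2 / 2, by positivity, fun _ => by nlinarith, fun h => absurd h (lt_irrefl _)⟩

/-- The profile of a radial weak solution is affine in `|x|²` in each layer. -/
lemma exists_affine_profile {N : ℕ} (hN : 1 ≤ N) {r : ℕ → ℝ}
    (hr0 : ∀ j, 1 ≤ j → j ≤ N → 0 < r j) (hr : ∀ j, 1 ≤ j → j < N → r (j + 1) < r j)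
    {lam mu : ℝ} (hlm : 0 < lam + 2 * mu) {ε : ℕ → ℂ}
    {v : Plane → CVec} {G : Plane → Fin 2 → Fin 2 → ℂ} (hv : HasH1LocGrad v G)
    (hG : IsWeakLame (epsField N r ε) lam mu G) {f : ℝ → ℂ}
    (hf : ∀ᵐ x : Plane, v x = f ‖x‖ • position x) {j : ℕ} (hj : j ≤ N) (hε : ε j ≠ 0) :
    ∃ a b : ℂ, ∀ᵐ s : ℝ, s ∈ shell N r j → profile f s = b + a * s := by
  refine ae_affine_of_weak_deriv_deriv (ordConnected_shell N r j) (isOpen_shell N r j)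
    (shell_nonempty hN hr0 hr hj) (locallyIntegrable_profile hv.l2 hf) fun χ hχ hχc hχs => ?_
  have h0 : (0 : ℝ) ∉ tsupport χ := fun h => lt_irrefl _ (hχs h).1
  -- Chosen so that `χ' = ψ + sψ'`; it is smooth because the shell omits the origin. The divergence
  -- tested with `χ'` then becomes the profile tested with `χ''`.
  set ψ : ℝ → ℝ := fun s => χ s * s⁻¹
  have hψs : tsupport ψ ⊆ tsupport χ := tsupport_mul_subset_left
  have hψ : ContDiff ℝ ∞ ψ := by
    rw [contDiff_iff_contDiffAt]
    intro s
    rcases eq_or_ne s 0 with rfl | hs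
    · refine (contDiffAt_const (c := (0 : ℝ))).congr_of_eventuallyEq ?_
      filter_upwards [(isClosed_tsupport χ).isOpen_compl.mem_nhds h0] with s hs
      simp [ψ, image_eq_zero_of_notMem_tsupport hs]
    · exact hχ.contDiffAt.mul (contDiffAt_inv ℝ hs)
  have hψc : HasCompactSupport ψ := hχc.mul_right
  have hmul : ∀ s, χ s = s * ψ s := by
    intro s
    rcases eq_or_ne s 0 with rfl | hs
    · simp [image_eq_zero_of_notMem_tsupport h0]
    · simp only [ψ]; field_simp
  have hder : ∀ s, deriv χ s = ψ s + s * deriv ψ s := by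
    intro s
    have h1 : HasDerivAt (fun s => s * ψ s) (1 * ψ s + s * deriv ψ s) s :=
      (hasDerivAt_id s).mul ((contDiff_infty_iff_deriv.1 hψ).1 s).hasDerivAt
    rw [funext hmul, h1.deriv, one_mul]
  have e1 := hG.integral_trace_eq_zero hr hlm hv hj hε hψ hψc
    (fun x hx => mem_layer_of_mem_shell hr0 hj (hχs (hψs hx)))
  simp_rw [← hder] at e1
  rw [hv.integral_trace hf (contDiff_infty_iff_deriv.1 hχ).2 hχc.deriv, neg_eq_zero] at e1
  have hc : (volume.real (Metric.ball (0 : Plane) 1) : ℂ) ≠ 0 := by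
    exact_mod_cast volume_ball_pos.ne'
  have e2 := (mul_eq_zero.1 e1).resolve_left (mul_ne_zero two_ne_zero hc)
  simpa [mul_comm] using e2

/-! ### Interfaces -/

/-- A sequence of bump functions concentrating at `σ`. -/
def shrinkingBump (σ : ℝ) {δ : ℝ} (hδ : 0 < δ) (n : ℕ) : ContDiffBump σ where
  rIn := δ / (n + 3)
  rOut := δ / (n + 2)
  rIn_pos := by positivity
  rIn_lt_rOut := by gcongr; norm_num

lemma shrinkingBump_self (σ : ℝ) {δ : ℝ} (hδ : 0 < δ) (n : ℕ) : shrinkingBump σ hδ n σ = 1 :=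
  ContDiffBump.one_of_mem_closedBall _ (Metric.mem_closedBall_self (shrinkingBump σ hδ n).rIn_pos.le)

lemma tsupport_shrinkingBump (σ : ℝ) {δ : ℝ} (hδ : 0 < δ) (n : ℕ) {s : ℝ}
    (hs : s ∈ tsupport (shrinkingBump σ hδ n)) : |s - σ| < δ := by
  rw [ContDiffBump.tsupport_eq, Metric.mem_closedBall, Real.dist_eq] at hs
  refine hs.trans_lt ?_
  change δ / (n + 2) < δ
  exact div_lt_self hδ (by have : (0 : ℝ) ≤ n := n.cast_nonneg; linarith)

lemma tendsto_integral_shrinkingBump {α : Type*} [MeasurableSpace α] {μ : Measure α} {p : α → ℝ}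
    (hp : Measurable p) {T : α → ℂ} {σ δ : ℝ} (hδ : 0 < δ)
    (hT : IntegrableOn T {x | |p x - σ| < δ} μ) (hne : ∀ᵐ x ∂μ, p x ≠ σ) :
    Filter.Tendsto (fun n => ∫ x, T x * (shrinkingBump σ hδ n (p x) : ℂ) ∂μ) Filter.atTop
      (nhds 0) := by
  have hS : MeasurableSet {x | |p x - σ| < δ} :=
    measurableSet_lt (by fun_prop) measurable_const
  have hi := (integrable_indicator_iff hS).2 hT
  have e : ∀ n x, T x * (shrinkingBump σ hδ n (p x) : ℂ)
      = Set.indicator {x | |p x - σ| < δ} T x * (shrinkingBump σ hδ n (p x) : ℂ) := by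
    intro n x
    by_cases hx : |p x - σ| < δ
    · rw [Set.indicator_of_mem (show x ∈ {x | |p x - σ| < δ} from hx)]
    · have : shrinkingBump σ hδ n (p x) = 0 :=
        image_eq_zero_of_notMem_tsupport fun h => hx (tsupport_shrinkingBump σ hδ n h)
      simp [this]
  simp_rw [e]
  rw [← integral_zero α ℂ (μ := μ)]
  refine tendsto_integral_of_dominated_convergence
    (fun x => ‖Set.indicator {x | |p x - σ| < δ} T x‖) (fun n => ?_) hi.norm (fun n => ?_) ?_
  · refine hi.aestronglyMeasurable.mul (Measurable.aestronglyMeasurable ?_)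
    exact Complex.measurable_ofReal.comp
      ((shrinkingBump σ hδ n).continuous.measurable.comp hp)
  · refine Filter.Eventually.of_forall fun x => ?_
    rw [norm_mul, Complex.norm_real, Real.norm_of_nonneg (ContDiffBump.nonneg _)]
    exact mul_le_of_le_one_right (norm_nonneg _) (ContDiffBump.le_one _)
  · filter_upwards [hne] with x hx
    have hpos : 0 < |p x - σ| := abs_pos.2 (sub_ne_zero.2 hx)
    obtain ⟨n₀, hn₀⟩ := exists_nat_gt (δ / |p x - σ|)
    refine tendsto_const_nhds.congr' ?_
    filter_upwards [Filter.eventually_ge_atTop n₀] with n hn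
    have h0 : shrinkingBump σ hδ n (p x) = 0 := by
      refine ContDiffBump.zero_of_le_dist _ ?_
      rw [Real.dist_eq]
      change δ / (n + 2) ≤ |p x - σ|
      rw [div_lt_iff₀ hpos] at hn₀
      have : (n₀ : ℝ) ≤ n := by exact_mod_cast hn
      rw [div_le_iff₀ (by positivity)]
      nlinarith
    simp [h0]

lemma ae_norm_sq_ne (σ : ℝ) : ∀ᵐ x : Plane, ‖x‖ ^ 2 ≠ σ := by
  filter_upwards [ae_norm_ne (√σ)] with x hx h
  exact hx (by rw [← h, Real.sqrt_sq (norm_nonneg x)])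

/-- The profile of a radial field in `H¹_loc` is continuous across interfaces. -/
lemma profile_continuous {v : Plane → CVec} {G : Plane → Fin 2 → Fin 2 → ℂ}
    (hv : HasH1LocGrad v G) {f : ℝ → ℂ} (hf : ∀ᵐ x : Plane, v x = f ‖x‖ • position x)
    {σ δ : ℝ} (hδ : 0 < δ) {α β α' β' : ℂ}
    (h1 : ∀ᵐ s : ℝ, σ - δ < s → s < σ → profile f s = α + β * s)
    (h2 : ∀ᵐ s : ℝ, σ < s → s < σ + δ → profile f s = α' + β' * s) :
    α + β * σ = α' + β' * σ := by
  set c : ℂ := (volume.real (Metric.ball (0 : Plane) 1) : ℂ)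
  have hc : c ≠ 0 := Complex.ofReal_ne_zero.2 volume_ball_pos.ne'
  -- The slope of the profile near `σ`. Any further contribution to the divergence is the jump `d`
  -- concentrated on the circle.
  set A : ℝ → ℂ := fun s => β' + (Set.Iio σ).indicator (fun _ => β - β') s
  have hA : LocallyIntegrable A :=
    (locallyIntegrable_const _).add ((locallyIntegrable_const _).indicator measurableSet_Iio)
  have hM := locallyIntegrable_profile hv.l2 hf
  have hT : LocallyIntegrable (fun x => G x 0 0 + G x 1 1) :=
    (hv.l2_grad 0 0).locallyIntegrable.add (hv.l2_grad 1 1).locallyIntegrable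
  set d := (α + β * σ) - (α' + β' * σ)
  have key : ∀ n, ∫ x, (G x 0 0 + G x 1 1) * (shrinkingBump σ hδ n (‖x‖ ^ 2) : ℂ)
      = -(2 * c * (d - ∫ s, A s * (shrinkingBump σ hδ n s : ℂ))) := by
    intro n
    have hb : ContDiff ℝ ∞ (shrinkingBump σ hδ n) := (shrinkingBump σ hδ n).contDiff
    have hbc := (shrinkingBump σ hδ n).hasCompactSupport
    have hz : ∀ s, ¬ |s - σ| < δ → shrinkingBump σ hδ n s = 0 ∧
        deriv (shrinkingBump σ hδ n) s = 0 := fun s hs =>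
      ⟨image_eq_zero_of_notMem_tsupport fun h => hs (tsupport_shrinkingBump σ hδ n h),
        by
          by_contra h
          exact hs (tsupport_shrinkingBump σ hδ n (support_deriv_subset h))⟩
    rw [hv.integral_trace hf hb hbc]
    have hP := integral_piecewise_affine hb hbc σ α β α' β'
      (P := fun s => A s * (shrinkingBump σ hδ n s : ℂ)
        + profile f s * ((deriv (shrinkingBump σ hδ n) s : ℝ) : ℂ)) ?_ ?_
    · have i1 : Integrable (fun s => A s * (shrinkingBump σ hδ n s : ℂ)) := by
        simpa [mul_comm] using integrable_smul_of_test hA hb hbc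
      have i2 : Integrable
          (fun s => profile f s * ((deriv (shrinkingBump σ hδ n) s : ℝ) : ℂ)) := by
        simpa [mul_comm] using
          integrable_smul_of_test hM (contDiff_infty_iff_deriv.1 hb).2 hbc.deriv
      rw [integral_add i1 i2, shrinkingBump_self, Complex.ofReal_one, mul_one] at hP
      rw [← eq_sub_iff_add_eq'] at hP
      rw [hP]
    · filter_upwards [h1] with s hs hsσ
      by_cases h : |s - σ| < δ
      · rw [hs (by linarith [neg_lt_of_abs_lt h]) hsσ]
        simp [A, hsσ]
      · simp [hz s h]
    · filter_upwards [h2] with s hs hsσ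
      by_cases h : |s - σ| < δ
      · rw [hs hsσ (by linarith [lt_of_abs_lt h])]
        simp [A, not_lt.2 hsσ.le]
      · simp [hz s h]
  -- The divergence and `A` are locally integrable, so both pairings vanish as the bumps shrink to
  -- the null set `s = σ`; comparison in `key` gives `d = 0`.
  have t1 : Filter.Tendsto
      (fun n => ∫ x, (G x 0 0 + G x 1 1) * (shrinkingBump σ hδ n (‖x‖ ^ 2) : ℂ)) Filter.atTop
      (nhds 0) := by
    refine tendsto_integral_shrinkingBump (p := fun x : Plane => ‖x‖ ^ 2) (by fun_prop) hδ ?_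
      (ae_norm_sq_ne σ)
    refine (hT.integrableOn_isCompact
      (isCompact_closedBall (0 : Plane) (|σ| + δ + 1))).mono_set fun x hx => ?_
    have hx' : |‖x‖ ^ 2 - σ| < δ := hx
    simp only [Metric.mem_closedBall, dist_zero_right]
    have := lt_of_abs_lt hx'
    nlinarith [le_abs_self σ, abs_nonneg σ, norm_nonneg x]
  have t2 : Filter.Tendsto (fun n => ∫ s, A s * (shrinkingBump σ hδ n s : ℂ)) Filter.atTop
      (nhds 0) := by
    refine tendsto_integral_shrinkingBump (p := fun s : ℝ => s) measurable_id hδ ?_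
      (by simp [ae_iff])
    refine (hA.integrableOn_isCompact (isCompact_closedBall σ δ)).mono_set fun s hs => ?_
    have hs' : |s - σ| < δ := hs
    simpa [Real.dist_eq] using hs'.le
  simp_rw [key] at t1
  have t3 := ((tendsto_const_nhds (x := d)).sub t2).const_mul (2 * c) |>.neg
  have h := tendsto_nhds_unique t1 t3
  rw [sub_zero, eq_comm, neg_eq_zero] at h
  exact sub_eq_zero.1 ((mul_eq_zero.1 h).resolve_left (mul_ne_zero two_ne_zero hc))

lemma IsWeakLame.congr {eps : Plane → ℂ} {lam mu : ℝ} {G G' : Plane → Fin 2 → Fin 2 → ℂ}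
    (hG : IsWeakLame eps lam mu G) (h : ∀ᵐ x, ∀ i j, G x i j = G' x i j) :
    IsWeakLame eps lam mu G' := by
  intro φ hφ
  rw [← hG φ hφ]
  refine integral_congr_ae ?_
  filter_upwards [h] with x hx
  simp only [symPart, hx]

lemma dipole_quadratic {x : Plane} (hx : x ≠ 0) :
    ∑ i, ∑ j, dipole x i j * (x i * x j) = -1 := by
  have h : x 0 ^ 2 + x 1 ^ 2 ≠ 0 := by
    rw [← norm_sq_eq]; exact pow_ne_zero 2 (norm_ne_zero_iff.2 hx)
  simp [Fin.sum_univ_two, dipole, norm_sq_eq]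
  field_simp
  ring

/-- The work of the stress `p I + q ∇(x / |x|²)` on the radial test field `ψ(|x|²) x`. -/
lemma sum_stress_radial {x : Plane} (hx : x ≠ 0) (p q : ℂ) (y y' : ℝ) :
    ∑ i, ∑ j, (p * kron i j + q * (dipole x i j : ℂ))
        * (((if i = j then y else 0) + 2 * x i * x j * y' : ℝ) : ℂ)
      = 2 * p * (y : ℂ) + (2 * p * (‖x‖ : ℂ) ^ 2 - 2 * q) * (y' : ℂ) := by
  have h1 : (dipole x 0 0 : ℂ) + dipole x 1 1 = 0 := by exact_mod_cast dipole_trace x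
  have h2 : ∑ i, ∑ j, (dipole x i j : ℂ) * (x i * x j) = -1 := by
    exact_mod_cast dipole_quadratic hx
  have h3 : (‖x‖ : ℂ) ^ 2 = (x 0 : ℂ) ^ 2 + (x 1 : ℂ) ^ 2 := by exact_mod_cast norm_sq_eq x
  simp only [Fin.sum_univ_two] at h2 ⊢
  rw [h3]
  simp [kron]
  linear_combination q * y * h1 + 2 * q * y' * h2

/-- A layered weak solution satisfies the flux conditions. -/
lemma fluxCondition_of_isWeakLame {N : ℕ} {r : ℕ → ℝ} (hr0 : ∀ j, 1 ≤ j → j ≤ N → 0 < r j)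
    (hr : ∀ j, 1 ≤ j → j < N → r (j + 1) < r j) {lam mu : ℝ} {ε : ℕ → ℂ} {a₀ : ℂ}
    {t : Fin N → ℂ} (hw : IsWeakLame (epsField N r ε) lam mu (layeredGrad r a₀ t)) (k : Fin N) :
    FluxCondition r lam mu ε (coefA a₀ t) (coefB r t) k := by
  obtain ⟨δ, hδ, hδσ, hin, hout⟩ := exists_interface_nhds hr0 hr k.2
  have hr1 := hr0 (k + 1) (by omega) k.2
  set σ := r (k + 1) ^ 2 with hσ
  set ψ : ℝ → ℝ := fun s => shrinkingBump σ hδ 0 s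
  have hψ : ContDiff ℝ ∞ ψ := (shrinkingBump σ hδ 0).contDiff
  have hc : HasCompactSupport ψ := (shrinkingBump σ hδ 0).hasCompactSupport
  have hz : ∀ s, ¬ |s - σ| < δ → ψ s = 0 ∧ deriv ψ s = 0 := fun s hs =>
    ⟨image_eq_zero_of_notMem_tsupport fun h => hs (tsupport_shrinkingBump σ hδ 0 h),
      by
        by_contra h
        exact hs (tsupport_shrinkingBump σ hδ 0 (support_deriv_subset h))⟩
  -- By `sum_stress_radial`, the work density in layer `j` is the derivative of `(α j + β j s) ψ`.
  -- Its integral is thus the jump of `α + β s` at `σ`, a multiple of the flux defect.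
  set β : ℕ → ℂ := fun j => 2 * (2 * (lam + mu) * (ε j * coefA a₀ t j))
  set α : ℕ → ℂ := fun j => -(2 * (2 * mu * (ε j * coefB r t j)))
  set E : ℕ → ℝ → ℂ := fun j s =>
    β j * (ψ s : ℂ) + (α j + β j * s) * ((deriv ψ s : ℝ) : ℂ)
  set P : ℝ → ℂ := fun s => if s < σ then E (k + 1) s else E k s
  have hPz : ∀ s, ¬ |s - σ| < δ → P s = 0 := fun s hs => by
    simp [P, E, hz s hs]
  have hP : ∫ s, P s = (α (k + 1) + β (k + 1) * σ) - (α k + β k * σ) := by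
    rw [integral_piecewise_affine hψ hc σ (α (k + 1)) (β (k + 1)) (α k) (β k),
      show ψ σ = 1 from shrinkingBump_self σ hδ 0, Complex.ofReal_one, mul_one]
    · exact Filter.Eventually.of_forall fun s hs => by simp [P, E, hs]
    · exact Filter.Eventually.of_forall fun s hs => by simp [P, E, not_lt.2 hs.le]
  have hwork := hw (fun i x => x i * ψ (‖x‖ ^ 2)) (isTest_norm_sq_mul hψ hc)
  have hint : ∫ x : Plane, P (‖x‖ ^ 2) = 0 := by
    rw [← hwork]
    refine integral_congr_ae ?_
    filter_upwards [ae_norm_sq_ne σ, ae_norm_ne 0] with x hxσ hx0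
    have hx0' : x ≠ 0 := norm_ne_zero_iff.1 hx0
    simp only [partialDeriv_norm_sq_mul hψ]
    by_cases hx : |‖x‖ ^ 2 - σ| < δ
    · have hcase : ∀ j ≤ N, ‖x‖ ^ 2 ∈ shell N r j → P (‖x‖ ^ 2) = E j (‖x‖ ^ 2) →
          P (‖x‖ ^ 2) = ∑ i, ∑ l, (∑ m, ∑ n, elasticTensor (epsField N r ε x * lam)
            (epsField N r ε x * mu) i l m n * symPart (layeredGrad r a₀ t x) m n)
            * (((if i = l then ψ (‖x‖ ^ 2) else 0)
              + 2 * x i * x l * deriv ψ (‖x‖ ^ 2) : ℝ) : ℂ) := by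
        intro j hj hxj hPj
        have hl := mem_layer_of_mem_shell hr0 hj hxj
        simp only [epsField_eq hr ε hj hl,
          sum_elasticTensor_dipole (ε j) lam mu _ _ (layeredGrad_eq hr a₀ t hj hl)]
        rw [sum_stress_radial hx0', hPj]
        simp only [E, α, β]
        push_cast
        ring
      rcases lt_or_gt_of_ne hxσ with h | h
      · exact hcase (k + 1) k.2 (hin _ (by linarith [neg_lt_of_abs_lt hx]) h) (by simp [P, h])
      · exact hcase k k.2.le (hout _ h (by linarith [lt_of_abs_lt hx]))
          (by simp [P, not_lt.2 h.le])
    · simp [hPz _ hx, hz _ hx]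
  rw [integral_norm_sq, setIntegral_eq_integral_of_forall_compl_eq_zero, hP, smul_eq_zero] at hint
  · have h := hint.resolve_left volume_ball_pos.ne'
    have hrc : (r (k + 1) : ℂ) ≠ 0 := by exact_mod_cast hr1.ne'
    unfold FluxCondition
    simp only [α, β, hσ] at h
    push_cast at h
    field_simp
    linear_combination (-1 / 4 : ℂ) * h
  -- Since `δ ≤ σ`, the support lies in `s > 0` and the half-line integral is the full one.
  · intro s hs
    refine hPz s fun h => hs ?_
    have := neg_lt_of_abs_lt h
    exact Set.mem_Ioi.2 (by linarith)

/-- A layered field is only asymptotic to its own background. -/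
lemma background_unique {N : ℕ} (hN : 1 ≤ N) {r : ℕ → ℝ}
    (hr : ∀ j, 1 ≤ j → j < N → r (j + 1) < r j) {a a₀ : ℂ} {t : Fin N → ℂ}
    (h : DecaysTo (layeredField r a t) (background a₀)) : a = a₀ := by
  obtain ⟨C, R, hR, hd⟩ := h
  by_contra hne
  have hpos : 0 < ‖a - a₀‖ := norm_pos_iff.2 (sub_ne_zero.2 hne)
  -- The decay bound forces `|x|² ≤ K` at every admissible far point, which fails once `|x| > K +
  -- 1`.
  set K : ℝ := (|C| + ‖coefB r t 0‖) / ‖a - a₀‖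
  have hdense := Measure.dense_of_ae hd
  obtain ⟨x, hx, hxd⟩ := hdense.exists_mem_open
    (U := {x : Plane | max (max R (r 1)) (K + 1) < ‖x‖})
    (isOpen_lt continuous_const continuous_norm) (by
      refine ⟨EuclideanSpace.single 0 (max (max R (r 1)) (K + 1) + 1), ?_⟩
      have : 0 < max (max R (r 1)) (K + 1) + 1 := by
        have := (le_max_left R (r 1)).trans (le_max_left _ (K + 1))
        linarith
      change _ < ‖_‖
      rw [norm_single_of_pos this]
      linarith)
  have hx' : max (max R (r 1)) (K + 1) < ‖x‖ := hxd
  simp only [max_lt_iff] at hx'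
  obtain ⟨⟨h1, h2⟩, h3⟩ := hx'
  have hx0 : 0 < ‖x‖ := hR.trans h1
  have e := hx h1.le
  rw [layeredField_eq hr a t (Nat.zero_le N) ((mem_layer_zero hN).2 h2), coefA_zero, background,
    ← sub_smul, norm_smul, norm_position] at e
  have hK : K * ‖a - a₀‖ = |C| + ‖coefB r t 0‖ := by
    simp only [K]; field_simp
  have hK0 : 0 ≤ K := by positivity
  have hxc : (‖x‖ : ℂ) ≠ 0 := by exact_mod_cast hx0.ne'
  have e2 : ‖a - a₀‖ * ‖x‖ ^ 2 ≤ |C| + ‖coefB r t 0‖ := by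
    have e3 : ‖a - a₀‖ ≤ ‖a + coefB r t 0 / (‖x‖ : ℂ) ^ 2 - a₀‖ + ‖coefB r t 0‖ / ‖x‖ ^ 2 := by
      have : a - a₀ = (a + coefB r t 0 / (‖x‖ : ℂ) ^ 2 - a₀) - coefB r t 0 / (‖x‖ : ℂ) ^ 2 := by
        ring
      have hn : ‖coefB r t 0 / (‖x‖ : ℂ) ^ 2‖ = ‖coefB r t 0‖ / ‖x‖ ^ 2 := by
        rw [norm_div, norm_pow, Complex.norm_real, norm_norm]
      rw [← hn]
      nth_rw 1 [this]
      exact norm_sub_le _ _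
    set w := ‖a + coefB r t 0 / (‖x‖ : ℂ) ^ 2 - a₀‖
    have e4 : w * ‖x‖ ^ 2 ≤ |C| := by
      have := mul_le_mul_of_nonneg_right e hx0.le
      calc w * ‖x‖ ^ 2 = w * ‖x‖ * ‖x‖ := by ring
        _ ≤ C * ‖x‖⁻¹ * ‖x‖ := this
        _ = C := by field_simp
        _ ≤ |C| := le_abs_self C
    calc ‖a - a₀‖ * ‖x‖ ^ 2 ≤ (w + ‖coefB r t 0‖ / ‖x‖ ^ 2) * ‖x‖ ^ 2 := by gcongr
      _ = w * ‖x‖ ^ 2 + ‖coefB r t 0‖ := by field_simp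
      _ ≤ _ := by linarith
  have e5 : ‖x‖ ^ 2 ≤ K := by
    rw [← hK, mul_comm] at e2
    exact le_of_mul_le_mul_right e2 hpos
  nlinarith

/-! ### Classification of radial solutions -/

/-- A radial solution is a layered field satisfying the flux conditions. -/
theorem IsSolution.eq_layeredField {N : ℕ} (hN : 1 ≤ N) {r : ℕ → ℝ}
    (hr0 : ∀ j, 1 ≤ j → j ≤ N → 0 < r j) (hr : ∀ j, 1 ≤ j → j < N → r (j + 1) < r j)
    {lam mu : ℝ} (hlm : 0 < lam + 2 * mu) {ε : ℕ → ℂ}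
    (hε : ∀ j, j ≤ N → ε j ≠ 0) {a₀ : ℂ} {v : Plane → CVec}
    (hv : IsSolution N r ε lam mu (background a₀) v) (hrad : IsRadial v) :
    ∃ t : Fin N → ℂ, (∀ k : Fin N, FluxCondition r lam mu ε (coefA a₀ t) (coefB r t) k) ∧
      v =ᵐ[volume] layeredField r a₀ t := by
  obtain ⟨⟨G, hG, hw⟩, hd⟩ := hv
  obtain ⟨f, hf⟩ := hrad
  have haff : ∀ j, j ≤ N → ∃ a b : ℂ, ∀ᵐ s : ℝ, s ∈ shell N r j → profile f s = b + a * s :=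
    fun j hj => exists_affine_profile hN hr0 hr hlm hG hw hf hj (hε j hj)
  choose! a b hab using haff
  have hbN : b N = 0 := by
    have h1 := hr0 N hN le_rfl
    -- The origin is treated as an interface: the profile is zero by definition for `s ≤ 0`, so
    -- continuity excludes the singular field `x/|x|²` from the core.
    have h2 := profile_continuous hG hf (σ := 0) (δ := r N ^ 2) (by positivity) (α := 0) (β := 0)
      (α' := b N) (β' := a N)
      (Filter.Eventually.of_forall fun s _ hs => by simp [profile, not_lt.2 hs.le]) (by
        filter_upwards [hab N le_rfl] with s hs h3 h4
        exact hs ⟨h3, fun _ => by linarith, fun h => absurd h (lt_irrefl N)⟩)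
    simpa using h2.symm
  have hcont : ∀ k : Fin N, b (k + 1) + a (k + 1) * (r (k + 1) : ℂ) ^ 2
      = b k + a k * (r (k + 1) : ℂ) ^ 2 := by
    intro k
    obtain ⟨δ, hδ, -, hin, hout⟩ := exists_interface_nhds hr0 hr k.2
    have := profile_continuous hG hf hδ (σ := r (k + 1) ^ 2) (α := b (k + 1)) (β := a (k + 1))
      (α' := b k) (β' := a k)
      (by
        filter_upwards [hab (k + 1) k.2] with s hs h1 h2
        exact hs (hin s h1 h2))
      (by
        filter_upwards [hab k k.2.le] with s hs h1 h2
        exact hs (hout s h1 h2))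
    simpa using this
  set t : Fin N → ℂ := fun k => a (k + 1) - a k
  have hA : ∀ j ≤ N, coefA (a 0) t j = a j := fun j hj => coefA_eq (fun k => by simp [t]) hj
  have hB : ∀ j ≤ N, coefB r t j = b j := fun j hj =>
    coefB_eq hbN (fun k => by simp only [t]; linear_combination -hcont k) hj
  have hvt : v =ᵐ[volume] layeredField r (a 0) t := by
    have hprof : ∀ᵐ x : Plane, ∀ j ≤ N, ‖x‖ ^ 2 ∈ shell N r j →
        profile f (‖x‖ ^ 2) = b j + a j * ((‖x‖ ^ 2 : ℝ) : ℂ) := by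
      refine ae_norm_sq (p := fun s => ∀ j ≤ N, s ∈ shell N r j → profile f s = b j + a j * s) ?_
      have : ∀ᵐ s : ℝ, ∀ j : ℕ, j ≤ N → s ∈ shell N r j → profile f s = b j + a j * s := by
        rw [ae_all_iff]
        intro j
        by_cases hj : j ≤ N
        · filter_upwards [hab j hj] with s hs _
          exact hs
        · exact Filter.Eventually.of_forall fun s h => absurd h hj
      filter_upwards [this] with s hs _
      exact hs
    have hne : ∀ᵐ x : Plane, ∀ j, ‖x‖ ≠ r j := ae_all_iff.2 fun j => ae_norm_ne (r j)
    filter_upwards [hf, hprof, ae_norm_ne 0, hne] with x hx hp hx0 hxr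
    obtain ⟨j, hj, hxj⟩ := exists_mem_layer N r x
    have hpos : 0 < ‖x‖ := lt_of_le_of_ne (norm_nonneg x) (Ne.symm hx0)
    have hsh : ‖x‖ ^ 2 ∈ shell N r j := mem_shell_of_mem_layer hr0 hpos hxr hxj
    have e := hp j hj hsh
    rw [profile_norm_sq] at e
    have hxc : (‖x‖ : ℂ) ≠ 0 := by exact_mod_cast hx0
    rw [layeredField_eq hr (a 0) t hj hxj, hA j hj, hB j hj, hx]
    congr 1
    field_simp
    push_cast at e
    linear_combination e
  have ha : a 0 = a₀ := by
    refine background_unique hN hr (t := t) ?_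
    obtain ⟨C, R, hR, h⟩ := hd
    refine ⟨C, R, hR, ?_⟩
    filter_upwards [h, hvt] with x hx e
    rwa [← e]
  rw [ha] at hvt
  refine ⟨t, fun k => fluxCondition_of_isWeakLame hr0 hr (hw.congr ?_) k, hvt⟩
  exact hG.ae_eq (hasH1LocGrad_layeredField hr0 a₀ t) hvt

end

end Lame2D
-- Assembly of the theorem
theorem mainTheorem7
    (N : ℕ) (hN : 1 ≤ N)
    (r : ℕ → ℝ) (hr_pos : ∀ j, 1 ≤ j → j ≤ N → 0 < r j)
    (hr_anti : ∀ j, 1 ≤ j → j < N → r (j + 1) < r j)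
    (lam mu : ℝ) (hmu : 0 < mu) (hconv : 0 < 2 * lam + 2 * mu)
    (ε : ℕ → ℂ) (hε₀_re : 0 < (ε 0).re) (hε₀_im : (ε 0).im = 0)
    (hε_im : ∀ j, 1 ≤ j → j ≤ N → 0 ≤ (ε j).im)
    (hε_ne : ∀ j, 1 ≤ j → j ≤ N → ε (j - 1) ≠ ε j)
    (a₀ : ℂ) :
    -- the solution of the Lamé system is represented by the momentum matrix
    (∀ u : Lame2D.Plane → Lame2D.CVec,
      Lame2D.IsTheSolution N r ε lam mu (Lame2D.background a₀) u →
        IsUnit (Lame2D.momentumMatrix N r lam mu ε) ∧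
        Lame2D.HasRepresentation N r lam mu ε (Lame2D.background a₀) u) ∧
    -- solvability when the momentum matrix is invertible
    (IsUnit (Lame2D.momentumMatrix N r lam mu ε) →
      ∃ u : Lame2D.Plane → Lame2D.CVec,
        Lame2D.IsSolution N r ε lam mu (Lame2D.background a₀) u ∧
        Lame2D.IsRadial u ∧
        Lame2D.HasRepresentation N r lam mu ε (Lame2D.background a₀) u ∧
        ((∀ j, 1 ≤ j → j ≤ N → ε j ≠ 0) →
          ∀ v : Lame2D.Plane → Lame2D.CVec,
            Lame2D.IsSolution N r ε lam mu (Lame2D.background a₀) v →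
            Lame2D.IsRadial v → v =ᵐ[MeasureTheory.volume] u)) := by
  have hiff : ∀ (a : ℂ) (t : Fin N → ℂ),
      (∀ k, Lame2D.FluxCondition r lam mu ε (Lame2D.coefA a t) (Lame2D.coefB r t) k) ↔
        (Lame2D.momentumMatrix N r lam mu ε).transpose.mulVec t = fun _ => a := fun a t => by
    rw [funext_iff]
    exact forall_congr' fun k => Lame2D.fluxCondition_iff hr_pos hconv hε_ne a t k
  have hex : IsUnit (Lame2D.momentumMatrix N r lam mu ε) →
      Lame2D.IsSolution N r ε lam mu (Lame2D.background a₀) (Lame2D.layeredField r a₀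
        (a₀ • ((Lame2D.momentumMatrix N r lam mu ε).transpose⁻¹).mulVec (fun _ => 1))) :=
    fun hP => Lame2D.isSolution_layeredField hN hr_pos hr_anti
      ((hiff _ _).2 ((Lame2D.transpose_mulVec_eq_iff hP a₀ _).2 rfl))
  refine ⟨fun u hu => ?_, fun hP => ⟨_, hex hP, Lame2D.isRadial_layeredField _ _ _,
    Lame2D.hasRepresentation_layeredField hr_anti lam mu ε a₀, fun hε v hv hrad => ?_⟩⟩
  · have hP : IsUnit (Lame2D.momentumMatrix N r lam mu ε) := by
      by_contra hP
      obtain ⟨t, ht, hPt⟩ := Lame2D.exists_kernel_of_not_isUnit hP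
      -- A kernel vector is the system with `a₀ = 0`: its layered field decays, so adding it to `u`
      -- gives a solution with the same background.
      have h1 := hu.2 _ (hu.1.add_layeredField hN hr_pos hr_anti ((hiff 0 t).2 hPt))
      refine ht (Lame2D.layeredField_injective hN hr_pos hr_anti ?_)
      filter_upwards [h1] with x hx
      simpa using hx
    exact ⟨hP, (Lame2D.hasRepresentation_layeredField hr_anti lam mu ε a₀).congr
      (hu.2 _ (hex hP)).symm⟩
  · have hε' : ∀ j, j ≤ N → ε j ≠ 0 := by
      intro j hj
      rcases Nat.eq_zero_or_pos j with rfl | h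
      -- The exterior coefficient is nonzero by positivity of its real part, so layer 0 is covered
      -- as well.
      · intro h; simp [h] at hε₀_re
      · exact hε j h hj
    obtain ⟨t, ht, hvt⟩ := hv.eq_layeredField hN hr_pos hr_anti (by linarith) hε' hrad
    rwa [(Lame2D.transpose_mulVec_eq_iff hP a₀ t).1 ((hiff _ _).1 ht)] at hvt
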